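/- **Setting.** There are $n$ arms. Arm $i$ has a finite state set $\mathcal S_i$ (pairwise disjoint; $\mathcal S=\bigcup_i\mathcal S_i$) carrying an out-arborescence $T_i$ with root $\rho_i$, with edge weights $p_{u,v}\ge 0$ satisfying $\sum_{v:\,u\to v}p_{u,v}=1$ for every non-leaf $u$, and each state $u$ has an arbitrary reward $r_u\ge 0$ (no martingale property is assumed). Every arm starts at its root. Playing (pulling) an arm whose current state is $u$ yields $r_u$ and moves that arm to a child $v$ of $u$ with probability $p_{u,v}$; after a leaf has been played the arm has ended. An adaptive strategy decides, as a function of the observed history, which arm to play next (or to stop); at most $B\in\mathbb N$ pulls are made in total. $\mathsf{Opt}$ is the largest expected total reward of an adaptive strategy. **LP.** $\mathsf{LPOpt}$ is the maximum of $\sum_{u\in\mathcal S}\sum_{t=1}^B r_u z_{u,t}$ over $z_{u,t},w_{u,t}\in[0,1]$ ($u\in\mathcal S$, $1\le t\le B$) subject to: $w_{u,t}=z_{\mathrm{parent}(u),t-1}\,p_{\mathrm{parent}(u),u}$ for non-roots $u$ and $2\le t\le B$, and $w_{u,1}=0$ for non-roots $u$; $w_{\rho_i,1}=1$ and $w_{\rho_i,t}=0$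 for $2\le t\le B$; $\sum_{t'\le t}z_{u,t'}\le\sum_{t'\le t}w_{u,t'}$ for all $u,t$; $\sum_{u\in\mathcal S}z_{u,t}\le 1$ for all $t$. **Algorithm AlgMAB**, run on an optimal LP solution $z$. *Phase I (for each arm $i$).* Let $\pi_u$ be the product of the transition probabilities on the path from $\rho_i$ to $u$. As long as $A=\{u\in\mathcal S_i:\sum_t z_{u,t}>0\}$ is non-empty, peel off a forest $j$: for $u\in A$ let $\mathsf{time}(i,j,u)$ be the least $t$ with $z_{u,t}>0$; let $\epsilon=\min_{u\in A}z_{u,\mathsf{time}(i,j,u)}/\pi_u$; set $\mathsf{prob}(i,j,u)=\epsilon\pi_u$ for $u\in A$; for all other states set $\mathsf{time}=\infty$ and $\mathsf{prob}=0$; subtract $\mathsf{prob}(i,j,u)$ from $z_{u,\mathsf{time}(i,j,u)}$ for each $u\in A$; repeat with the new $z$. *Phase II (for each forest).* Depth is measured from the root, which has depth $0$. A non-root state of finite time is contiguous with its parent if its time is its parent's time plus $1$; a head is a state not contiguous with its parent, and the component of a head consists of the states reached from it by contiguous edges. For $\tau=B,B-1,\dots,1$: while there is a non-root head $v$ with $\mathsf{time}(v)=\tau<2\,\mathrm{depth}(v)$,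 advance its component, keeping it contiguous, so that $\mathsf{time}(v)=\mathsf{time}(\mathrm{parent}(v))+1$. *Phase III.* Independently for each arm $i$, choose forest $j$ with probability $\mathsf{prob}(i,j,\rho_i)/24$, and ignore the arm with the remaining probability. Then repeatedly: among the non-ignored arms whose current state has finite time in the chosen forest, take the one with the smallest such time (the smallest index in case of ties), and play it as long as its new state is contiguous with the state just played. An arm whose current state has time $\infty$, or which has ended, is abandoned. **Theorem.** There is a universal constant $c>0$ such that for every such instance and every budget $B$ the LP has an optimal solution, and for every optimal LP solution the sampling probabilities above are well defined (non-negative with sum $1$), and the expected total reward of the first $B$ pulls made by AlgMAB is at least $c\cdot\mathsf{LPOpt}$. Moreover every adaptive strategy making at most $B$ pulls has expected reward at most $\mathsf{LPOpt}$, i.e. $\mathsf{LPOpt}\ge\mathsf{Opt}$. Hence AlgMAB earns at least $c\cdot\mathsf{Opt}$ within the first $B$ pulls, a constant-factor approximation. -/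

import Mathlib

open Finset
open scoped Classical

noncomputable section

/-- A multi-armed bandit with `n` arms whose transition graphs are finite out-arborescences.
`S` is the (disjoint) union of the state sets of the arms and `arm u` is the arm owning `u`.
The tree of arm `i` is rooted at `root i`; `parent u` is the unique in-neighbour of `u` (`none`
exactly for roots), it lies in the same arm and one level higher. `p u v` is the probability of
moving from `u` to its child `v` when `u` is played, and `r u` is the reward for playing `u`.
A leaf has no outgoing transition: playing it yields its reward, after which the arm has ended.
No martingale property is imposed on the rewards. -/
structure TreeMAB (n : ℕ) (S : Type*) [Fintype S] where
  arm : S → Fin n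
  root : Fin n → S
  parent : S → Option S
  depth : S → ℕ
  p : S → S → ℝ
  r : S → ℝ
  arm_root : ∀ i, arm (root i) = i
  parent_eq_none_iff : ∀ u, parent u = none ↔ u = root (arm u)
  arm_parent : ∀ u v, parent u = some v → arm u = arm v
  depth_root : ∀ i, depth (root i) = 0
  depth_parent : ∀ u v, parent u = some v → depth u = depth v + 1
  p_nonneg : ∀ u v, 0 ≤ p u v
  p_eq_zero : ∀ u v, parent v ≠ some u → p u v = 0
  p_sum : ∀ u, (∃ v, parent v = some u) → ∑ v, p u v = 1
  r_nonneg : ∀ u, 0 ≤ r u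

/-- A label of the states of an arm by a time of play (`⊤` meaning `never`) and a probability of
being played; strategy forests are such labels. -/
structure Forest (S : Type*) where
  time : S → ℕ∞
  prob : S → ℝ

namespace TreeMAB

variable {n : ℕ} {S : Type*} [Fintype S] (M : TreeMAB n S)

/-! ### Adaptive strategies and their expected reward -/

/-- What has been observed so far, most recent pull first: the arm that was pulled, and its new
state (`none` if the arm has ended). -/
abbrev History (_M : TreeMAB n S) : Type _ := List (Fin n × Option S)

/-- A (history-dependent) adaptive strategy: which arm to pull next, or `none` to stop. -/
abbrev Strategy (M : TreeMAB n S) : Type _ := M.History → Option (Fin n)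

/-- The current state of arm `i` after a history (`none` if the arm has ended). -/
def curr : M.History → Fin n → Option S
  | [], i => some (M.root i)
  | (j, s) :: h, i => if j = i then s else curr h i

def IsLeaf (u : S) : Prop := ∀ v, M.parent v ≠ some u

/-- The expectation of `f` at the random state entered when `u` is played. -/
def expNext (u : S) (f : Option S → ℝ) : ℝ :=
  if M.IsLeaf u then f none else ∑ v, M.p u v * f (some v)

/-- The expected reward collected by the strategy `π` in its next `k` pulls after a history `h`.
Pulling an arm that has ended wastes the pull. -/
def rewardFrom (π : M.Strategy) : ℕ → M.History → ℝ
  | 0, _ => 0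
  | k + 1, h =>
    match π h with
    | none => 0
    | some i =>
      match M.curr h i with
      | none => rewardFrom π k ((i, none) :: h)
      | some u => M.r u + M.expNext u (fun s => rewardFrom π k ((i, s) :: h))

/-- The expected total reward of the first `B` pulls of the strategy `π`. -/
def reward (B : ℕ) (π : M.Strategy) : ℝ := M.rewardFrom π B []

/-! ### The global time-indexed linear program -/

/-- Feasibility for the linear program. `z u t` and `w u t` (with `1 ≤ t ≤ B`) stand for the
probabilities of playing, and of entering, the state `u` at time `t`. -/
structure LPFeasible (B : ℕ) (z w : S → ℕ → ℝ) : Prop where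
  z_mem : ∀ u, ∀ t ∈ Icc 1 B, z u t ∈ Set.Icc (0 : ℝ) 1
  w_mem : ∀ u, ∀ t ∈ Icc 1 B, w u t ∈ Set.Icc (0 : ℝ) 1
  w_child : ∀ u v, M.parent u = some v → ∀ t ∈ Icc 2 B, w u t = z v (t - 1) * M.p v u
  w_child_one : ∀ u v, M.parent u = some v → w u 1 = 0
  w_root_one : ∀ i, w (M.root i) 1 = 1
  w_root : ∀ i, ∀ t ∈ Icc 2 B, w (M.root i) t = 0
  z_le_w : ∀ u, ∀ t ∈ Icc 1 B, ∑ t' ∈ Icc 1 t, z u t' ≤ ∑ t' ∈ Icc 1 t, w u t'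
  z_load : ∀ t ∈ Icc 1 B, ∑ u, z u t ≤ 1

/-- The objective function of the linear program. -/
def lpValue (B : ℕ) (z : S → ℕ → ℝ) : ℝ := ∑ u, ∑ t ∈ Icc 1 B, M.r u * z u t

/-- `(z, w)` is an optimal solution of the linear program, so that `M.lpValue B z` is `LPOpt`. -/
def LPOptimal (B : ℕ) (z w : S → ℕ → ℝ) : Prop :=
  M.LPFeasible B z w ∧ ∀ z' w', M.LPFeasible B z' w' → M.lpValue B z' ≤ M.lpValue B z

/-! ### Phase I: decomposition into strategy forests -/

/-- The product of the transition probabilities on the path from the root to `u`. -/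
def pathProb (u : S) : ℝ :=
  match h : M.parent u with
  | none => 1
  | some v => pathProb v * M.p v u
termination_by M.depth u
decreasing_by
  have := M.depth_parent u v h
  omega

/-- The states of arm `i` that are still played by the residual solution `z`. -/
def playedStates (B : ℕ) (i : Fin n) (z : S → ℕ → ℝ) : Finset S :=
  {u | M.arm u = i ∧ 0 < ∑ t ∈ Icc 1 B, z u t}

/-- The smallest time at which `z` plays `u` (only used for states in `playedStates`). -/
def firstTime (_M : TreeMAB n S) (B : ℕ) (z : S → ℕ → ℝ) (u : S) : ℕ :=
  sInf {t : ℕ | t ∈ Icc 1 B ∧ 0 < z u t}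

/-- The strategy forest peeled off from the residual solution `z` of arm `i`. -/
def peel (B : ℕ) (i : Fin n) (z : S → ℕ → ℝ) (hA : (M.playedStates B i z).Nonempty) :
    Forest S where
  time u := if u ∈ M.playedStates B i z then (M.firstTime B z u : ℕ∞) else ⊤
  prob u :=
    if u ∈ M.playedStates B i z then
      (M.playedStates B i z).inf' hA (fun v => z v (M.firstTime B z v) / M.pathProb v)
        * M.pathProb u
    else 0

/-- The residual solution after peeling off the forest `F`. -/
def residual (_M : TreeMAB n S) (z : S → ℕ → ℝ) (F : Forest S) : S → ℕ → ℝ :=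
  fun u t => if F.time u = (t : ℕ∞) then z u t - F.prob u else z u t

/-- The peeling loop for arm `i`, with at most `k` iterations. -/
def decompose (B : ℕ) (i : Fin n) : ℕ → (S → ℕ → ℝ) → List (Forest S)
  | 0, _ => []
  | k + 1, z =>
    if hA : (M.playedStates B i z).Nonempty then
      M.peel B i z hA :: decompose B i k (M.residual z (M.peel B i z hA))
    else []

/-- The convex decomposition of arm `i`. For a feasible `z`, every iteration of the loop makes a
positive value `z u t` vanish, so the loop ends within `|S| * B` iterations. -/
def phaseI (B : ℕ) (z : S → ℕ → ℝ) (i : Fin n) : List (Forest S) :=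
  M.decompose B i (Fintype.card S * B) z

/-! ### Phase II: gap filling -/

/-- `u` is the parent of `v`, and `v` is played immediately after `u`. -/
def Contiguous (F : Forest S) (u v : S) : Prop :=
  M.parent v = some u ∧ F.time v ≠ ⊤ ∧ F.time v = F.time u + 1

/-- `v` is the head of its connected component. -/
def IsHead (F : Forest S) (v : S) : Prop := ∀ u, ¬ M.Contiguous F u v

/-- For a head `v`: `u` belongs to the connected component of `v`. -/
def InComp (F : Forest S) (v u : S) : Prop := Relation.ReflTransGen (M.Contiguous F) v u

/-- `v` is a head, with parent `v'`, played at time `τ < 2 * depth v`. -/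
def GapAt (τ : ℕ) (F : Forest S) (v v' : S) : Prop :=
  M.IsHead F v ∧ M.parent v = some v' ∧ F.time v = (τ : ℕ∞) ∧ τ < 2 * M.depth v

/-- Advance the component of the head `v`, so that `v` is played immediately after its parent
`v'` and the component stays contiguous. -/
def advance (F : Forest S) (v v' : S) : Forest S where
  time u :=
    if M.InComp F v u then F.time v' + 1 + ((M.depth u - M.depth v : ℕ) : ℕ∞) else F.time u
  prob := F.prob

/-- Advance the component of some head having a gap at time `τ`, if there is one. -/
def gapStep (τ : ℕ) (F : Forest S) : Forest S :=
  if h : ∃ v v', M.GapAt τ F v v' then M.advance F h.choose h.choose_spec.choose else F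

/-- Gap filling for `τ = k, k - 1, …, 1`. An advanced head never becomes a head again, so `|S|`
steps for every `τ` exhaust the heads having a gap at time `τ`. -/
def gapFill : ℕ → Forest S → Forest S
  | 0, F => F
  | τ + 1, F => gapFill τ ((M.gapStep (τ + 1))^[Fintype.card S] F)

/-- The strategy forests of arm `i` after the first two phases. -/
def forests (B : ℕ) (z : S → ℕ → ℝ) (i : Fin n) : List (Forest S) :=
  (M.phaseI B z i).map (M.gapFill B)

/-! ### Phase III: scheduling -/

/-- The time at which the forest `T i` chosen for arm `i` plays the current state of arm `i`;
it is `⊤` if the arm is ignored (`T i = none`), has been abandoned or has ended. -/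
def nextTime (T : Fin n → Option (Forest S)) (h : M.History) (i : Fin n) : ℕ∞ :=
  match T i, M.curr h i with
  | some F, some u => F.time u
  | _, _ => ⊤

/-- The active arm whose current state is played earliest, with ties broken in favour of the
smallest index; `none` if no arm is active. -/
def earliest (T : Fin n → Option (Forest S)) (h : M.History) : Option (Fin n) :=
  (List.finRange n).find? fun i =>
    decide (M.nextTime T h i ≠ ⊤ ∧ ∀ j, M.nextTime T h i ≤ M.nextTime T h j)

/-- The scheduling phase for the chosen forests `T`: continue with the arm pulled last as long as
its new state is scheduled immediately after the state just played (so connected components are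
played contiguously), and otherwise switch to the earliest active arm. -/
def schedule (T : Fin n → Option (Forest S)) : M.Strategy
  | [] => M.earliest T []
  | (i, s) :: h =>
    if M.nextTime T ((i, s) :: h) i ≠ ⊤ ∧
        M.nextTime T ((i, s) :: h) i = M.nextTime T h i + 1 then
      some i
    else M.earliest T ((i, s) :: h)

/-- A choice `σ i` for arm `i`: the index of one of its forests, or `none` to ignore the arm. -/
abbrev Choice (B : ℕ) (z : S → ℕ → ℝ) (i : Fin n) : Type :=
  Option (Fin (M.forests B z i).length)

/-- The probability with which arm `i` makes the choice `o`: forest `j` is sampled with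
probability `prob (i, j, root i) / 24`, and the arm is ignored with the remaining probability. -/
def sampleProb (B : ℕ) (z : S → ℕ → ℝ) (i : Fin n) (o : M.Choice B z i) : ℝ :=
  match o with
  | some j => ((M.forests B z i).get j).prob (M.root i) / 24
  | none => 1 - ∑ j, ((M.forests B z i).get j).prob (M.root i) / 24

/-- The expected reward of the first `B` pulls of the randomized algorithm run on `z`: the arms
sample their forests independently, and the resulting schedule is followed. -/
def algReward (B : ℕ) (z : S → ℕ → ℝ) : ℝ :=
  ∑ σ : (∀ i, M.Choice B z i), (∏ i, M.sampleProb B z i (σ i)) *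
    M.reward B (M.schedule fun i => (σ i).map (M.forests B z i).get)

end TreeMAB

end

noncomputable section

namespace TreeMAB

section

variable {n : ℕ} {S : Type*} [Fintype S] (M : TreeMAB n S)

/-! ### Transition probabilities -/

section Transitions

variable {M}

/-! Upper bound. The probabilities that a strategy plays `u` at its `t`-th pull are feasible for the
LP. The only real constraint is `visits_succ_le`: up to pull `k + 1`, a non-root is played at most
as often in expectation as its parent up to pull `k`, times the edge probability. An optimum exists
by compactness.

Decomposition. Eliminating `w` leaves prefix inequalities between each state and its parent
(`IsResidual`). They force first play times to increase along edges and survive the removal of a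
forest. Each removal kills a positive entry, so the forests add up exactly to `z` (`sum_decompose`).

Gap filling. Afterwards every state of finite time lies on a contiguous run whose head `v` has time
at least `2 * depth v` (`exists_head`). The price is load. If `x` is moved to time `s` from a later
time, take its deepest ancestor originally scheduled by `s`. The next state on the path was moved as
well, hence `s < 2 * depth` there, so at least `s / 2` ancestors of `x` were originally scheduled by
`s`. Charge `x` to them: the states of new time `s` form an antichain, so each ancestor is charged
at most its own probability. With original load at most 1 per time, the new load is at most `1 + 2 =
3` (`mul_playMass_le`, `sum_playMass_forests_le`).

Scheduling. Let arm `i` choose a forest containing `u`, whose run has head `v` of time `t`. Until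
`v` is reached, another arm is pulled only at a scheduled time at most `t` plus the number `c` of
such pulls so far, since a run started by time `t` advances by one per pull. Thus, while `c < t /
2`, these pulls have scheduled times below `2 * t`. After division by 24 the expected number of such
plays is at most `3 * (2 * t) / 24 = t / 4`, so by Markov's inequality `c` stays below `t / 2` with
probability at least 1/2. Then `v` is played by pull `t`, because `depth v ≤ t / 2`, and its run
leads to `u` within the budget. The Markov step is carried out as a backward induction on a
potential (`reach_mul_le_visits`). Independence of the arms gives `u` half its path probability, and
the overall constant is `1 / 24 * 1 / 2 = 1 / 48`. -/

lemma parent_of_p_ne_zero {u v : S} (h : M.p u v ≠ 0) : M.parent v = some u := by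
  by_contra hv
  exact h (M.p_eq_zero u v hv)

lemma depth_of_p_ne_zero {u v : S} (h : M.p u v ≠ 0) : M.depth v = M.depth u + 1 :=
  M.depth_parent _ _ (parent_of_p_ne_zero h)

lemma IsLeaf.p_eq_zero {u : S} (h : M.IsLeaf u) (v : S) : M.p u v = 0 :=
  M.p_eq_zero u v (h v)

lemma sum_p_of_not_isLeaf {u : S} (h : ¬ M.IsLeaf u) : ∑ v, M.p u v = 1 := by
  refine M.p_sum u ?_
  simpa [IsLeaf] using h

end Transitions

lemma sum_p_le_one (u : S) : ∑ v, M.p u v ≤ 1 := by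
  by_cases h : M.IsLeaf u
  · simp [h.p_eq_zero]
  · exact (sum_p_of_not_isLeaf h).le

lemma p_le_one (u v : S) : M.p u v ≤ 1 :=
  (single_le_sum (f := fun v => M.p u v) (fun v _ => M.p_nonneg u v) (mem_univ v)).trans
    (M.sum_p_le_one u)

lemma parent_root (i : Fin n) : M.parent (M.root i) = none := by
  rw [M.parent_eq_none_iff, M.arm_root]

lemma eq_root_of_parent_eq_none {u : S} (h : M.parent u = none) : u = M.root (M.arm u) :=
  (M.parent_eq_none_iff u).1 h

/-- Induction along the tree: from parents to children. -/
lemma tree_induction {motive : S → Prop} (root : ∀ u, M.parent u = none → motive u)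
    (child : ∀ u v, M.parent u = some v → motive v → motive u) (u : S) : motive u := by
  induction hd : M.depth u using Nat.strong_induction_on generalizing u with
  | _ d ih =>
    rcases hp : M.parent u with _ | v
    · exact root u hp
    · have := M.depth_parent u v hp
      exact child u v hp (ih _ (by omega) v rfl)

lemma pathProb_of_parent_eq_none {u : S} (h : M.parent u = none) : M.pathProb u = 1 := by
  rw [pathProb]
  split <;> simp_all

lemma pathProb_of_parent {u v : S} (h : M.parent u = some v) :
    M.pathProb u = M.pathProb v * M.p v u := by
  rw [pathProb]
  split <;> simp_all

lemma pathProb_root (i : Fin n) : M.pathProb (M.root i) = 1 :=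
  M.pathProb_of_parent_eq_none (M.parent_root i)

lemma pathProb_nonneg (u : S) : 0 ≤ M.pathProb u := by
  induction u using M.tree_induction with
  | root u h => simp [M.pathProb_of_parent_eq_none h]
  | child u v h ih => rw [M.pathProb_of_parent h]; exact mul_nonneg ih (M.p_nonneg _ _)

/-- The probability that an arm in state `x` eventually enters `y`, if it is played forever. -/
def reach (x y : S) : ℝ :=
  if x = y then 1 else
    match _h : M.parent y with
    | none => 0
    | some v => reach x v * M.p v y
termination_by M.depth y
decreasing_by
  have := M.depth_parent y v _h
  omega

lemma reach_self (x : S) : M.reach x x = 1 := by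
  rw [reach]; simp

lemma reach_of_parent_eq_none {x y : S} (hxy : x ≠ y) (h : M.parent y = none) :
    M.reach x y = 0 := by
  rw [reach, if_neg hxy]
  split <;> simp_all

lemma reach_of_parent {x y v : S} (hxy : x ≠ y) (h : M.parent y = some v) :
    M.reach x y = M.reach x v * M.p v y := by
  rw [reach, if_neg hxy]
  split <;> simp_all

lemma reach_nonneg (x y : S) : 0 ≤ M.reach x y := by
  by_cases hxy : x = y
  · simp [hxy, reach_self]
  induction y using M.tree_induction with
  | root y h => simp [M.reach_of_parent_eq_none hxy h]
  | child y v h ih =>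
    rw [M.reach_of_parent hxy h]
    refine mul_nonneg ?_ (M.p_nonneg _ _)
    by_cases hv : x = v
    · simp [hv, reach_self]
    · exact ih hv

/-- If `f` increases by at least one along every edge, it increases along every path by at least
the number of its edges. -/
lemma le_of_reach_ne_zero {f : S → ℕ∞} (hf : ∀ u v, M.parent u = some v → f v + 1 ≤ f u)
    {x y : S} (h : M.reach x y ≠ 0) :
    M.depth x ≤ M.depth y ∧ f x + ((M.depth y - M.depth x : ℕ) : ℕ∞) ≤ f y := by
  induction y using M.tree_induction with
  | root y hy =>
    by_cases hxy : x = y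
    · simp [hxy]
    · exact absurd (M.reach_of_parent_eq_none hxy hy) h
  | child y v hy ih =>
    by_cases hxy : x = y
    · simp [hxy]
    · rw [M.reach_of_parent hxy hy] at h
      obtain ⟨h1, h2⟩ := ih (left_ne_zero_of_mul h)
      have hd := M.depth_parent y v hy
      refine ⟨by omega, le_trans ?_ (hf y v hy)⟩
      have : M.depth y - M.depth x = (M.depth v - M.depth x) + 1 := by omega
      rw [this, Nat.cast_add, Nat.cast_one, ← add_assoc]
      gcongr

lemma depth_le_of_reach_ne_zero {x y : S} (h : M.reach x y ≠ 0) : M.depth x ≤ M.depth y :=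
  (M.le_of_reach_ne_zero (f := fun u => (M.depth u : ℕ∞))
    (fun u v huv => by rw [M.depth_parent u v huv]; push_cast; rfl) h).1

/-- First-step decomposition, whereas the definition of `reach` peels off the last step. Both are
needed: strategies unfold from the first pull, labels from the parent. -/
lemma reach_eq_sum {x y : S} (hxy : x ≠ y) : M.reach x y = ∑ s, M.p x s * M.reach s y := by
  induction y using M.tree_induction with
  | root y hy =>
    rw [M.reach_of_parent_eq_none hxy hy]
    refine (sum_eq_zero fun s _ => ?_).symm
    by_cases hs : s = y
    · rw [hs, M.p_eq_zero x y (by simp [hy]), zero_mul]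
    · rw [M.reach_of_parent_eq_none hs hy, mul_zero]
  | child y v hy ih =>
    rw [M.reach_of_parent hxy hy]
    by_cases hv : x = v
    · subst hv
      rw [reach_self, one_mul, sum_eq_single y]
      · rw [reach_self, mul_one]
      · intro s _ hs
        rw [M.reach_of_parent hs hy]
        by_cases hp : M.p x s = 0
        · simp [hp]
        have h0 : M.reach s x = 0 := by
          by_contra hr
          have h1 := M.depth_le_of_reach_ne_zero hr
          have h2 := depth_of_p_ne_zero hp
          omega
        simp [h0]
      · simp
    · rw [ih hv, sum_mul]
      refine sum_congr rfl fun s _ => ?_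
      by_cases hs : s = y
      · have h0 : M.p x s = 0 := M.p_eq_zero x s (by rw [hs, hy]; simpa using Ne.symm hv)
        simp [h0]
      · rw [M.reach_of_parent hs hy, mul_assoc]

lemma reach_root {i : Fin n} {y : S} (hy : M.arm y = i) : M.reach (M.root i) y = M.pathProb y := by
  induction y using M.tree_induction with
  | root y h =>
    rw [M.pathProb_of_parent_eq_none h, ← hy, ← M.eq_root_of_parent_eq_none h, reach_self]
  | child y v h ih =>
    have hne : M.root i ≠ y := by
      rintro rfl
      simp [M.parent_root] at h
    rw [M.reach_of_parent hne h, M.pathProb_of_parent h, ih (by rw [← hy, M.arm_parent y v h])]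

/-! ### The state entered after a play -/

section ExpNext

variable {M}

lemma expNext_mono {u : S} {f g : Option S → ℝ} (h0 : f none ≤ g none)
    (h : ∀ v, M.p u v ≠ 0 → f (some v) ≤ g (some v)) : M.expNext u f ≤ M.expNext u g := by
  unfold expNext
  split_ifs
  · exact h0
  · refine sum_le_sum fun v _ => ?_
    by_cases hv : M.p u v = 0
    · simp [hv]
    · exact mul_le_mul_of_nonneg_left (h v hv) (M.p_nonneg _ _)

lemma expNext_const (u : S) (a : ℝ) : M.expNext u (fun _ => a) = a := by
  unfold expNext
  split_ifs with h
  · rfl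
  · rw [← sum_mul, sum_p_of_not_isLeaf h, one_mul]

lemma expNext_add (u : S) (f g : Option S → ℝ) :
    M.expNext u (fun s => f s + g s) = M.expNext u f + M.expNext u g := by
  unfold expNext
  split_ifs
  · rfl
  · simp [mul_add, sum_add_distrib]

lemma expNext_mul (u : S) (a : ℝ) (f : Option S → ℝ) :
    M.expNext u (fun s => a * f s) = a * M.expNext u f := by
  unfold expNext
  split_ifs
  · rfl
  · rw [mul_sum]
    exact sum_congr rfl fun v _ => by ring

lemma expNext_nonneg {u : S} {f : Option S → ℝ} (h : ∀ s, 0 ≤ f s) : 0 ≤ M.expNext u f := by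
  rw [← expNext_const (M := M) u 0]
  exact expNext_mono (h _) fun v _ => h _

lemma expNext_eq_sum (u : S) {f : Option S → ℝ} (h : f none = 0) :
    M.expNext u f = ∑ v, M.p u v * f (some v) := by
  unfold expNext
  split_ifs with hu
  · simp [h, hu.p_eq_zero]
  · rfl

end ExpNext

/-! ### The law of a strategy -/

/-- The expectation of `g x + f h'`, where the strategy `π` plays the state `x` after the history
`h`, which thereby becomes `h'`; it is `0` if `π` stops. -/
def step (π : M.Strategy) (h : M.History) (g : S → ℝ) (f : M.History → ℝ) : ℝ :=
  match π h with
  | none => 0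
  | some i =>
    match M.curr h i with
    | none => f ((i, none) :: h)
    | some x => g x + M.expNext x (fun s => f ((i, s) :: h))

section Step

variable {M} {π : M.Strategy} {h : M.History}

lemma step_of_eq_none {g : S → ℝ} {f : M.History → ℝ} (hπ : π h = none) :
    M.step π h g f = 0 := by
  simp [step, hπ]

lemma step_of_curr_eq_none {g : S → ℝ} {f : M.History → ℝ} {i : Fin n} (hπ : π h = some i)
    (hi : M.curr h i = none) : M.step π h g f = f ((i, none) :: h) := by
  simp [step, hπ, hi]

lemma step_of_curr {g : S → ℝ} {f : M.History → ℝ} {i : Fin n} {x : S} (hπ : π h = some i)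
    (hi : M.curr h i = some x) :
    M.step π h g f = g x + M.expNext x (fun s => f ((i, s) :: h)) := by
  simp [step, hπ, hi]

lemma step_cases (π : M.Strategy) (h : M.History) :
    π h = none ∨ (∃ i, π h = some i ∧ M.curr h i = none) ∨
      ∃ i x, π h = some i ∧ M.curr h i = some x := by
  rcases hπ : π h with _ | i
  · simp
  · rcases hi : M.curr h i with _ | x <;> simp [hi]

lemma step_add (g g' : S → ℝ) (f f' : M.History → ℝ) :
    M.step π h (fun x => g x + g' x) (fun h => f h + f' h) =
      M.step π h g f + M.step π h g' f' := by
  rcases step_cases π h with hπ | ⟨i, hπ, hi⟩ | ⟨i, x, hπ, hi⟩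
  · simp [step_of_eq_none hπ]
  · simp [step_of_curr_eq_none hπ hi]
  · simp only [step_of_curr hπ hi, expNext_add]
    ring

lemma step_mul (a : ℝ) (g : S → ℝ) (f : M.History → ℝ) :
    M.step π h (fun x => a * g x) (fun h => a * f h) = a * M.step π h g f := by
  rcases step_cases π h with hπ | ⟨i, hπ, hi⟩ | ⟨i, x, hπ, hi⟩
  · simp [step_of_eq_none hπ]
  · simp [step_of_curr_eq_none hπ hi]
  · simp only [step_of_curr hπ hi, expNext_mul]
    ring

lemma step_zero : M.step π h (fun _ => 0) (fun _ => 0) = 0 := by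
  simpa using step_mul (π := π) (h := h) 0 (fun _ => 0) (fun _ => 0)

lemma step_sum {ι : Type*} (A : Finset ι) (g : ι → S → ℝ) (f : ι → M.History → ℝ) :
    M.step π h (fun x => ∑ a ∈ A, g a x) (fun h => ∑ a ∈ A, f a h) =
      ∑ a ∈ A, M.step π h (g a) (f a) := by
  induction A using Finset.induction_on with
  | empty => simpa using step_zero
  | insert a A ha ih => simp only [sum_insert ha]; rw [step_add, ih]

lemma step_nonneg {g : S → ℝ} {f : M.History → ℝ} (hg : ∀ x, 0 ≤ g x) (hf : ∀ h, 0 ≤ f h) :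
    0 ≤ M.step π h g f := by
  rcases step_cases π h with hπ | ⟨i, hπ, hi⟩ | ⟨i, x, hπ, hi⟩
  · simp [step_of_eq_none hπ]
  · simp [step_of_curr_eq_none hπ hi, hf]
  · rw [step_of_curr hπ hi]
    exact add_nonneg (hg _) (expNext_nonneg fun _ => hf _)

end Step

variable (π : M.Strategy)

lemma rewardFrom_succ (k : ℕ) (h : M.History) :
    M.rewardFrom π (k + 1) h = M.step π h M.r (M.rewardFrom π k) := rfl

/-- The probability that, after the history `h` and `t` further pulls, the strategy plays `u`. -/
def playAt (u : S) : ℕ → M.History → ℝ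
  | 0, h => M.step π h (fun x => if x = u then 1 else 0) (fun _ => 0)
  | t + 1, h => M.step π h (fun _ => 0) (playAt u t)

/-- The expected number of times that `u` is played in the next `k` pulls after `h`. -/
def visits (u : S) (k : ℕ) (h : M.History) : ℝ := ∑ t ∈ range k, M.playAt π u t h

lemma playAt_nonneg (u : S) (t : ℕ) (h : M.History) : 0 ≤ M.playAt π u t h := by
  induction t generalizing h with
  | zero => exact step_nonneg (fun x => by split_ifs <;> simp) fun _ => le_rfl
  | succ t ih => exact step_nonneg (fun _ => le_rfl) ih

lemma visits_nonneg (u : S) (k : ℕ) (h : M.History) : 0 ≤ M.visits π u k h :=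
  sum_nonneg fun t _ => M.playAt_nonneg π u t h

lemma visits_zero (u : S) (h : M.History) : M.visits π u 0 h = 0 := by simp [visits]

lemma visits_succ (u : S) (k : ℕ) (h : M.History) :
    M.visits π u (k + 1) h =
      M.step π h (fun x => if x = u then 1 else 0) (M.visits π u k) := by
  -- Padding with zero terms separates the present play from the sum over future pulls, in the shape
  -- required by `step_add` and `step_sum`.
  have h1 : M.step π h (fun x => if x = u then 1 else 0) (M.visits π u k) =
      M.step π h (fun x => (if x = u then 1 else 0) + ∑ t ∈ range k, 0)
        (fun h => 0 + ∑ t ∈ range k, M.playAt π u t h) := by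
    simp
    rfl
  rw [h1, step_add, step_sum, visits, sum_range_succ']
  rw [add_comm]
  rfl

lemma rewardFrom_eq_sum_visits (k : ℕ) (h : M.History) :
    M.rewardFrom π k h = ∑ u, M.r u * M.visits π u k h := by
  induction k generalizing h with
  | zero => simp [rewardFrom, visits_zero]
  | succ k ih =>
    have h1 : M.step π h M.r (M.rewardFrom π k) =
        M.step π h (fun x => ∑ u, M.r u * if x = u then 1 else 0)
          (fun h => ∑ u, M.r u * M.visits π u k h) := by
      congr 1
      · simp
      · exact funext ih
    rw [rewardFrom_succ, h1, step_sum]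
    simp only [visits_succ, step_mul]

lemma sum_playAt_le_one (t : ℕ) (h : M.History) : ∑ u, M.playAt π u t h ≤ 1 := by
  induction t generalizing h with
  | zero =>
    simp only [playAt]
    rw [← step_sum]
    rcases step_cases π h with hπ | ⟨i, hπ, hi⟩ | ⟨i, x, hπ, hi⟩
    · simp [step_of_eq_none hπ]
    · simp [step_of_curr_eq_none hπ hi]
    · simp [step_of_curr hπ hi, expNext_const]
  | succ t ih =>
    simp only [playAt]
    rw [← step_sum]
    rcases step_cases π h with hπ | ⟨i, hπ, hi⟩ | ⟨i, x, hπ, hi⟩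
    · simp [step_of_eq_none hπ]
    · simpa [step_of_curr_eq_none hπ hi] using ih _
    · rw [step_of_curr hπ hi]
      simp only [sum_const_zero, zero_add]
      rw [← expNext_const (M := M) x 1]
      exact expNext_mono (ih _) fun v _ => ih _

end

section

variable {n : ℕ} {S : Type*} [Fintype S] (M : TreeMAB n S)

/-! ### Strategies and the linear program -/

/-- In the history `h`, the current state of every arm belongs to this arm. -/
def IsValid (h : M.History) : Prop := ∀ i x, M.curr h i = some x → M.arm x = i

variable {M}

lemma isValid_nil : M.IsValid [] := by
  intro i x hx
  simp only [curr, Option.some.injEq] at hx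
  rw [← hx, M.arm_root]

lemma IsValid.cons_none {h : M.History} (hh : M.IsValid h) (i : Fin n) :
    M.IsValid ((i, none) :: h) := by
  intro j x hx
  simp only [curr] at hx
  split_ifs at hx
  exact hh j x hx

lemma IsValid.cons_some {h : M.History} (hh : M.IsValid h) {i : Fin n} {x s : S}
    (hx : M.curr h i = some x) (hs : M.p x s ≠ 0) : M.IsValid ((i, some s) :: h) := by
  intro j y hy
  simp only [curr] at hy
  split_ifs at hy with hij
  · obtain rfl : s = y := by simpa using hy
    rw [M.arm_parent s x (parent_of_p_ne_zero hs), hh i x hx, hij]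
  · exact hh j y hy

variable (M)

/-- A state can be played only once per entry, and entering `u` costs a play of its parent at an
earlier pull. The hypothesis on `v` is phrased through `p` so that roots are covered as well: no
transition leads to them and any `v` will do. Validity of the history ensures that only the arm
owning `u` can play it. -/
lemma visits_succ_le (π : M.Strategy) {u v : S} (huv : ∀ v', M.p v' u ≠ 0 → v' = v) (k : ℕ)
    {h : M.History} (hh : M.IsValid h) :
    M.visits π u (k + 1) h ≤
      (if M.curr h (M.arm u) = some u then 1 else 0) + M.p v u * M.visits π v k h := by
  induction k generalizing h with
  | zero =>
    rw [visits_succ, visits_zero, mul_zero, add_zero]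
    rcases step_cases π h with hπ | ⟨i, hπ, hi⟩ | ⟨i, x, hπ, hi⟩
    · rw [step_of_eq_none hπ]
      split_ifs <;> simp
    · rw [step_of_curr_eq_none hπ hi, visits_zero]
      split_ifs <;> simp
    · rw [step_of_curr hπ hi]
      simp only [visits_zero, expNext_const, add_zero]
      by_cases hx : x = u
      · subst hx
        rw [hh i x hi, if_pos hi, if_pos rfl]
      · rw [if_neg hx]
        split_ifs <;> simp
  | succ k ih =>
    rw [visits_succ, visits_succ M π v k]
    rcases step_cases π h with hπ | ⟨i, hπ, hi⟩ | ⟨i, x, hπ, hi⟩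
    · rw [step_of_eq_none hπ, step_of_eq_none hπ]
      split_ifs <;> simp
    · rw [step_of_curr_eq_none hπ hi, step_of_curr_eq_none hπ hi]
      refine (ih (hh.cons_none i)).trans (add_le_add_left ?_ _)
      by_cases hu : i = M.arm u
      · subst hu
        simp [curr, hi]
      · simp [curr, hu]
    · rw [step_of_curr hπ hi, step_of_curr hπ hi]
      have h1 : M.expNext x (fun s => M.visits π u (k + 1) ((i, s) :: h)) ≤
          M.expNext x (fun s => (if M.curr ((i, s) :: h) (M.arm u) = some u then (1 : ℝ) else 0)) +
            M.p v u * M.expNext x (fun s => M.visits π v k ((i, s) :: h)) := by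
        rw [← expNext_mul, ← expNext_add]
        exact expNext_mono (ih (hh.cons_none i)) fun s hs => ih (hh.cons_some hi hs)
      -- One pull: playing `u` uses up its availability as a current state, and playing `v` makes
      -- `u` available with probability `p v u`.
      have h2 : (if x = u then (1 : ℝ) else 0) +
          M.expNext x (fun s => (if M.curr ((i, s) :: h) (M.arm u) = some u then (1 : ℝ) else 0)) ≤
          (if M.curr h (M.arm u) = some u then 1 else 0) +
            M.p v u * (if x = v then 1 else 0) := by
        by_cases hu : i = M.arm u
        · subst hu
          simp only [curr, if_true, hi, Option.some.injEq]
          refine add_le_add_right ?_ _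
          rw [expNext_eq_sum _ (by simp)]
          simp only [Option.some.injEq, mul_ite, mul_one, mul_zero, sum_ite_eq', mem_univ, if_true]
          by_cases hp : M.p x u = 0
          · rw [hp]
            split_ifs
            · exact M.p_nonneg _ _
            · rfl
          · rw [huv x hp, if_pos rfl]
        · have hxu : x ≠ u := by
            rintro rfl
            exact hu (hh i x hi).symm
          simp only [curr, if_neg hu, if_neg hxu, expNext_const, zero_add]
          refine le_add_of_nonneg_right (mul_nonneg (M.p_nonneg _ _) ?_)
          split_ifs <;> simp
      linarith

/-- The probabilities with which a strategy plays and enters the states at the various times. -/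
def strategyZ (π : M.Strategy) (u : S) (t : ℕ) : ℝ := M.playAt π u (t - 1) []

/-- The probabilities of entering the states if `z` gives those of playing them. -/
def entering (z : S → ℕ → ℝ) (u : S) (t : ℕ) : ℝ :=
  match M.parent u with
  | none => if t = 1 then 1 else 0
  | some v => if t = 1 then 0 else z v (t - 1) * M.p v u

lemma entering_of_parent_eq_none (z : S → ℕ → ℝ) {u : S} (h : M.parent u = none) (t : ℕ) :
    M.entering z u t = if t = 1 then 1 else 0 := by
  simp [entering, h]

lemma entering_of_parent (z : S → ℕ → ℝ) {u v : S} (h : M.parent u = some v) (t : ℕ) :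
    M.entering z u t = if t = 1 then 0 else z v (t - 1) * M.p v u := by
  simp [entering, h]

lemma sum_strategyZ (π : M.Strategy) (u : S) (t : ℕ) :
    ∑ t' ∈ Icc 1 t, M.strategyZ π u t' = M.visits π u t [] := by
  induction t with
  | zero => simp [visits]
  | succ t ih => rw [sum_Icc_succ_top (by omega), ih, visits, visits, sum_range_succ]; rfl

lemma sum_entering_of_parent (z : S → ℕ → ℝ) {u v : S} (h : M.parent u = some v) (t : ℕ) :
    ∑ t' ∈ Icc 1 (t + 1), M.entering z u t' = M.p v u * ∑ t' ∈ Icc 1 t, z v t' := by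
  induction t with
  | zero => simp [M.entering_of_parent z h]
  | succ t ih =>
    rw [sum_Icc_succ_top (by omega), ih, sum_Icc_succ_top (by omega), M.entering_of_parent z h,
      if_neg (by omega), Nat.add_sub_cancel]
    ring

lemma lpFeasible_strategyZ (B : ℕ) (π : M.Strategy) :
    M.LPFeasible B (M.strategyZ π) (M.entering (M.strategyZ π)) := by
  have hload (t : ℕ) : ∑ u, M.strategyZ π u t ≤ 1 := M.sum_playAt_le_one π _ _
  have hz (u : S) (t : ℕ) : M.strategyZ π u t ∈ Set.Icc (0 : ℝ) 1 :=
    ⟨M.playAt_nonneg π _ _ _, (single_le_sum (f := fun u => M.strategyZ π u t)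
      (fun u _ => M.playAt_nonneg π u _ _) (mem_univ u)).trans (hload t)⟩
  refine ⟨fun u t _ => hz u t, fun u t _ => ?_, fun u v huv t ht => ?_, fun u v huv => ?_,
    fun i => ?_, fun i t ht => ?_, fun u t ht => ?_, fun t _ => hload t⟩
  · rcases hp : M.parent u with _ | v
    · rw [M.entering_of_parent_eq_none _ hp]
      split_ifs <;> simp
    · rw [M.entering_of_parent _ hp]
      split_ifs
      · simp
      · exact ⟨mul_nonneg (hz _ _).1 (M.p_nonneg _ _),
          mul_le_one₀ (hz _ _).2 (M.p_nonneg _ _) (M.p_le_one _ _)⟩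
  · rw [mem_Icc] at ht
    rw [M.entering_of_parent _ huv, if_neg (by omega)]
  · rw [M.entering_of_parent _ huv, if_pos rfl]
  · rw [M.entering_of_parent_eq_none _ (M.parent_root i), if_pos rfl]
  · rw [mem_Icc] at ht
    rw [M.entering_of_parent_eq_none _ (M.parent_root i), if_neg (by omega)]
  · rw [mem_Icc] at ht
    obtain ⟨t, rfl⟩ : ∃ k, t = k + 1 := ⟨t - 1, by omega⟩
    rw [sum_strategyZ]
    rcases hp : M.parent u with _ | v
    · have h0 (v : S) : M.p v u = 0 := M.p_eq_zero v u (by simp [hp])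
      have := M.visits_succ_le π (u := u) (v := u) (fun v' h => absurd (h0 v') h) t isValid_nil
      rw [h0, zero_mul, add_zero] at this
      refine this.trans ?_
      simp only [M.entering_of_parent_eq_none _ hp, sum_ite_eq', mem_Icc]
      split_ifs <;> simp_all
    · have := M.visits_succ_le π (u := u) (v := v) (fun v' h => by
        simpa [hp] using (parent_of_p_ne_zero h).symm) t isValid_nil
      rw [M.sum_entering_of_parent _ hp, sum_strategyZ]
      refine this.trans ?_
      rw [if_neg, zero_add]
      simp only [curr, Option.some.injEq]
      intro h
      rw [← h, parent_root] at hp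
      simp at hp

lemma reward_eq_lpValue_strategyZ (B : ℕ) (π : M.Strategy) :
    M.reward B π = M.lpValue B (M.strategyZ π) := by
  simp only [reward, rewardFrom_eq_sum_visits, lpValue, ← mul_sum, sum_strategyZ]

lemma reward_le_lpValue {B : ℕ} {z w : S → ℕ → ℝ} (hz : M.LPOptimal B z w) (π : M.Strategy) :
    M.reward B π ≤ M.lpValue B z := by
  rw [reward_eq_lpValue_strategyZ]
  exact hz.2 _ _ (M.lpFeasible_strategyZ B π)

/-- A feasible solution may be replaced by `0` at the times that do not matter. -/
lemma LPFeasible.truncate {M : TreeMAB n S} {B : ℕ} {z w : S → ℕ → ℝ} (h : M.LPFeasible B z w) :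
    M.LPFeasible B (fun u t => if t ∈ Icc 1 B then z u t else 0)
      (fun u t => if t = 1 ∨ t ∈ Icc 1 B then w u t else 0) := by
  refine ⟨fun u t ht => ?_, fun u t ht => ?_, fun u v huv t ht => ?_, fun u v huv => ?_,
    fun i => ?_, fun i t ht => ?_, fun u t ht => ?_, fun t ht => ?_⟩
  · simpa only [if_pos ht] using h.z_mem u t ht
  · simpa only [ht, or_true, if_true] using h.w_mem u t ht
  · have ht' := mem_Icc.1 ht
    rw [if_pos (Or.inr (mem_Icc.2 (by omega))), if_pos (mem_Icc.2 (by omega))]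
    exact h.w_child u v huv t ht
  · simpa using h.w_child_one u v huv
  · simpa using h.w_root_one i
  · simp [h.w_root i t ht]
  · rw [mem_Icc] at ht
    have h1 : ∀ t' ∈ Icc 1 t, t' ∈ Icc 1 B := fun t' ht' => by
      rw [mem_Icc] at ht' ⊢
      omega
    rw [sum_congr rfl fun t' ht' => if_pos (h1 t' ht'),
      sum_congr rfl fun t' ht' => if_pos (Or.inr (h1 t' ht'))]
    exact h.z_le_w u t (mem_Icc.2 ht)
  · simpa only [if_pos ht] using h.z_load t ht

/-- Each constraint is a closed condition on finitely many coordinates, hence closed in the product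
topology. -/
lemma isClosed_lpFeasible (B : ℕ) :
    IsClosed {x : (S → ℕ → ℝ) × (S → ℕ → ℝ) | M.LPFeasible B x.1 x.2} := by
  have : {x : (S → ℕ → ℝ) × (S → ℕ → ℝ) | M.LPFeasible B x.1 x.2} =
      {x | (∀ u, ∀ t ∈ Icc 1 B, x.1 u t ∈ Set.Icc (0 : ℝ) 1) ∧
      (∀ u, ∀ t ∈ Icc 1 B, x.2 u t ∈ Set.Icc (0 : ℝ) 1) ∧
      (∀ u v, M.parent u = some v → ∀ t ∈ Icc 2 B, x.2 u t = x.1 v (t - 1) * M.p v u) ∧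
      (∀ u v, M.parent u = some v → x.2 u 1 = 0) ∧
      (∀ i, x.2 (M.root i) 1 = 1) ∧
      (∀ i, ∀ t ∈ Icc 2 B, x.2 (M.root i) t = 0) ∧
      (∀ u, ∀ t ∈ Icc 1 B, ∑ t' ∈ Icc 1 t, x.1 u t' ≤ ∑ t' ∈ Icc 1 t, x.2 u t') ∧
      (∀ t ∈ Icc 1 B, ∑ u, x.1 u t ≤ 1)} := by
    ext x
    exact ⟨fun ⟨a, b, c, d, e, f, g, h⟩ => ⟨a, b, c, d, e, f, g, h⟩,
      fun ⟨a, b, c, d, e, f, g, h⟩ => ⟨a, b, c, d, e, f, g, h⟩⟩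
  rw [this]
  simp only [Set.ofPred_and, Set.ofPred_forall]
  refine .inter ?_ (.inter ?_ (.inter ?_ (.inter ?_ (.inter ?_ (.inter ?_ (.inter ?_ ?_))))))
  · exact isClosed_iInter fun _ => isClosed_iInter fun _ => isClosed_iInter fun _ =>
      isClosed_Icc.preimage (by fun_prop)
  · exact isClosed_iInter fun _ => isClosed_iInter fun _ => isClosed_iInter fun _ =>
      isClosed_Icc.preimage (by fun_prop)
  · exact isClosed_iInter fun _ => isClosed_iInter fun _ => isClosed_iInter fun _ =>
      isClosed_iInter fun _ => isClosed_iInter fun _ =>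
        isClosed_eq (by fun_prop) (by fun_prop)
  · exact isClosed_iInter fun _ => isClosed_iInter fun _ => isClosed_iInter fun _ =>
      isClosed_eq (by fun_prop) (by fun_prop)
  · exact isClosed_iInter fun _ => isClosed_eq (by fun_prop) (by fun_prop)
  · exact isClosed_iInter fun _ => isClosed_iInter fun _ => isClosed_iInter fun _ =>
      isClosed_eq (by fun_prop) (by fun_prop)
  · exact isClosed_iInter fun _ => isClosed_iInter fun _ => isClosed_iInter fun _ =>
      isClosed_le (by fun_prop) (by fun_prop)
  · exact isClosed_iInter fun _ => isClosed_iInter fun _ =>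
      isClosed_le (by fun_prop) (by fun_prop)

/-- The linear program has an optimal solution. -/
lemma exists_lpOptimal (B : ℕ) : ∃ z w : S → ℕ → ℝ, M.LPOptimal B z w := by
  -- The feasible set is not compact, since values beyond time `B` are free. Truncation moves any
  -- feasible point into this compact box without changing the objective.
  let K : Set ((S → ℕ → ℝ) × (S → ℕ → ℝ)) :=
    (Set.univ.pi fun _ => Set.univ.pi fun _ => Set.Icc 0 1) ×ˢ
      (Set.univ.pi fun _ => Set.univ.pi fun _ => Set.Icc 0 1)
  have hK : IsCompact K :=
    (isCompact_univ_pi fun _ => isCompact_univ_pi fun _ => isCompact_Icc).prod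
      (isCompact_univ_pi fun _ => isCompact_univ_pi fun _ => isCompact_Icc)
  have htrunc {z w : S → ℕ → ℝ} (h : M.LPFeasible B z w) :
      ((fun u t => if t ∈ Icc 1 B then z u t else 0),
        (fun u t => if t = 1 ∨ t ∈ Icc 1 B then w u t else 0)) ∈
        K ∩ {x | M.LPFeasible B x.1 x.2} := by
    refine ⟨⟨fun u _ t _ => ?_, fun u _ t _ => ?_⟩, h.truncate⟩
    · dsimp only
      split_ifs with ht
      · exact h.z_mem u t ht
      · simp
    · dsimp only
      split_ifs with ht
      · rcases ht with rfl | ht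
        · rcases hp : M.parent u with _ | v
          · rw [M.eq_root_of_parent_eq_none hp, h.w_root_one]
            simp
          · rw [h.w_child_one u v hp]
            simp
        · exact h.w_mem u t ht
      · simp
  have hcont : Continuous fun x : (S → ℕ → ℝ) × (S → ℕ → ℝ) => M.lpValue B x.1 := by
    unfold lpValue
    fun_prop
  obtain ⟨⟨z, w⟩, hzw, hmax⟩ := (hK.inter_right (M.isClosed_lpFeasible B)).exists_isMaxOn
    ⟨_, htrunc (M.lpFeasible_strategyZ B fun _ => none)⟩ hcont.continuousOn
  refine ⟨z, w, hzw.2, fun z' w' h' => le_of_eq_of_le ?_ (hmax (htrunc h'))⟩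
  exact sum_congr rfl fun u _ => sum_congr rfl fun t ht => by simp only [if_pos ht]

end

section

variable {n : ℕ} {S : Type*} [Fintype S] (M : TreeMAB n S)

/-! ### The decomposition into strategy forests -/

/-- The label `F` describes a strategy for arm `i` that only plays at times `1, …, B`. -/
structure IsStrategyForest (B : ℕ) (i : Fin n) (F : Forest S) : Prop where
  arm_eq : ∀ u, F.time u ≠ ⊤ → M.arm u = i
  one_le : ∀ u, 1 ≤ F.time u
  le_of_ne_top : ∀ u, F.time u ≠ ⊤ → F.time u ≤ B
  succ_le : ∀ u v, M.parent u = some v → F.time v + 1 ≤ F.time u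
  prob_eq : ∀ u, F.prob u = if F.time u = ⊤ then 0 else F.prob (M.root i) * M.pathProb u
  prob_root_nonneg : 0 ≤ F.prob (M.root i)

/-- The constraints of the linear program that concern arm `i` and survive peeling. -/
structure IsResidual (B : ℕ) (i : Fin n) (z : S → ℕ → ℝ) : Prop where
  nonneg : ∀ u, M.arm u = i → ∀ t ∈ Icc 1 B, 0 ≤ z u t
  le_parent : ∀ u v, M.parent u = some v → M.arm u = i → ∀ t, t + 1 ≤ B →
    ∑ t' ∈ Icc 1 (t + 1), z u t' ≤ M.p v u * ∑ t' ∈ Icc 1 t, z v t'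

variable {M}

lemma LPFeasible.isResidual {B : ℕ} {z w : S → ℕ → ℝ} (h : M.LPFeasible B z w) (i : Fin n) :
    M.IsResidual B i z := by
  refine ⟨fun u _ t ht => (h.z_mem u t ht).1, fun u v huv _ t ht => ?_⟩
  refine (h.z_le_w u (t + 1) (mem_Icc.2 (by omega))).trans (le_of_eq ?_)
  rw [← M.sum_entering_of_parent z huv]
  refine sum_congr rfl fun s hs => ?_
  rw [mem_Icc] at hs
  rw [M.entering_of_parent z huv]
  split_ifs with h1
  · rw [h1, h.w_child_one u v huv]
  · exact h.w_child u v huv s (mem_Icc.2 (by omega))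

variable {B : ℕ} {i : Fin n} {z : S → ℕ → ℝ}

lemma mem_playedStates {u : S} :
    u ∈ M.playedStates B i z ↔ M.arm u = i ∧ 0 < ∑ t ∈ Icc 1 B, z u t := by
  simp [playedStates]

omit [Fintype S] in
lemma exists_pos_of_sum_pos {u : S} {t : ℕ} (h : 0 < ∑ t' ∈ Icc 1 t, z u t') :
    ∃ s ∈ Icc 1 t, 0 < z u s := by
  by_contra! hc
  exact absurd (sum_nonpos hc) (not_le.2 h)

lemma firstTime_spec {u : S} (hu : u ∈ M.playedStates B i z) :
    M.firstTime B z u ∈ Icc 1 B ∧ 0 < z u (M.firstTime B z u) := by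
  obtain ⟨s, hs⟩ := exists_pos_of_sum_pos (mem_playedStates.1 hu).2
  exact Nat.sInf_mem (s := {t : ℕ | t ∈ Icc 1 B ∧ 0 < z u t}) ⟨s, hs⟩

lemma firstTime_le {u : S} {t : ℕ} (ht : t ∈ Icc 1 B) (h : 0 < z u t) :
    M.firstTime B z u ≤ t :=
  Nat.sInf_le (s := {t : ℕ | t ∈ Icc 1 B ∧ 0 < z u t}) ⟨ht, h⟩

/-! ### Peeling one forest off a residual solution -/

namespace IsResidual

variable (hz : M.IsResidual B i z)
include hz

lemma eq_zero_of_notMem {u : S} (hu : M.arm u = i) (hA : u ∉ M.playedStates B i z) {t : ℕ}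
    (ht : t ∈ Icc 1 B) : z u t = 0 := by
  rw [mem_playedStates] at hA
  push Not at hA
  have h := hA hu
  have h0 : ∑ t ∈ Icc 1 B, z u t = 0 := le_antisymm h (sum_nonneg (hz.nonneg u hu))
  exact (sum_eq_zero_iff_of_nonneg (hz.nonneg u hu)).1 h0 t ht

/-- Positive mass of `u` at its first time forces, by the prefix inequality, a positive edge
probability and positive mass of the parent strictly earlier. Hence the played states are closed
under parents. -/
lemma parent_mem {u v : S} (huv : M.parent u = some v) (hu : u ∈ M.playedStates B i z) :
    v ∈ M.playedStates B i z ∧ M.firstTime B z v + 1 ≤ M.firstTime B z u ∧ 0 < M.p v u := by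
  have hui := (mem_playedStates.1 hu).1
  have hvi : M.arm v = i := by rw [← M.arm_parent u v huv, hui]
  obtain ⟨h1, h2⟩ := firstTime_spec hu
  rw [mem_Icc] at h1
  obtain ⟨t, ht⟩ : ∃ t, M.firstTime B z u = t + 1 := ⟨M.firstTime B z u - 1, by omega⟩
  have h3 : 0 < ∑ t' ∈ Icc 1 (t + 1), z u t' := by
    refine sum_pos' (fun s hs => hz.nonneg u hui s ?_) ⟨t + 1, by simp, ht ▸ h2⟩
    rw [mem_Icc] at hs ⊢
    omega
  have h4 := h3.trans_le (hz.le_parent u v huv hui t (by omega))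
  have hp : 0 < M.p v u := by
    refine lt_of_le_of_ne (M.p_nonneg v u) fun h => ?_
    rw [← h, zero_mul] at h4
    exact lt_irrefl _ h4
  obtain ⟨s, hs, hs'⟩ := exists_pos_of_sum_pos (pos_of_mul_pos_right h4 hp.le)
  rw [mem_Icc] at hs
  have hsB : s ∈ Icc 1 B := mem_Icc.2 (by omega)
  refine ⟨mem_playedStates.2 ⟨hvi, sum_pos' (hz.nonneg v hvi) ⟨s, hsB, hs'⟩⟩, ?_, hp⟩
  have := firstTime_le (M := M) hsB hs'
  omega

lemma pathProb_pos {u : S} (hu : u ∈ M.playedStates B i z) : 0 < M.pathProb u := by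
  induction u using M.tree_induction with
  | root u h => simp [M.pathProb_of_parent_eq_none h]
  | child u v h ih =>
    rw [M.pathProb_of_parent h]
    exact mul_pos (ih (hz.parent_mem h hu).1) (hz.parent_mem h hu).2.2

lemma root_mem {u : S} (hu : u ∈ M.playedStates B i z) : M.root i ∈ M.playedStates B i z := by
  induction u using M.tree_induction with
  | root u h =>
    rw [← (mem_playedStates.1 hu).1, ← M.eq_root_of_parent_eq_none h]
    rwa [(mem_playedStates.1 hu).1]
  | child u v h ih => exact ih (hz.parent_mem h hu).1

variable (hA : (M.playedStates B i z).Nonempty)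

lemma eps_pos : 0 < (M.playedStates B i z).inf' hA
    (fun v => z v (M.firstTime B z v) / M.pathProb v) := by
  rw [lt_inf'_iff]
  exact fun u hu => div_pos (firstTime_spec hu).2 (hz.pathProb_pos hu)

omit hz in
lemma peel_time_of_mem {u : S} (hu : u ∈ M.playedStates B i z) :
    (M.peel B i z hA).time u = (M.firstTime B z u : ℕ∞) := if_pos hu

omit hz in
lemma peel_time_of_notMem {u : S} (hu : u ∉ M.playedStates B i z) :
    (M.peel B i z hA).time u = ⊤ := if_neg hu

omit hz in
lemma mem_of_peel_time_ne_top {u : S} (hu : (M.peel B i z hA).time u ≠ ⊤) :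
    u ∈ M.playedStates B i z := by
  by_contra h
  exact hu (peel_time_of_notMem hA h)

omit hz in
lemma peel_prob_of_mem {u : S} (hu : u ∈ M.playedStates B i z) :
    (M.peel B i z hA).prob u = (M.playedStates B i z).inf' hA
      (fun v => z v (M.firstTime B z v) / M.pathProb v) * M.pathProb u := if_pos hu

omit hz in
lemma peel_prob_of_notMem {u : S} (hu : u ∉ M.playedStates B i z) :
    (M.peel B i z hA).prob u = 0 := if_neg hu

lemma isStrategyForest_peel : M.IsStrategyForest B i (M.peel B i z hA) := by
  have hr : M.root i ∈ M.playedStates B i z := hA.elim fun a ha => hz.root_mem ha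
  refine ⟨fun u hu => ?_, fun u => ?_, fun u hu => ?_, fun u v huv => ?_, fun u => ?_, ?_⟩
  · exact (mem_playedStates.1 (mem_of_peel_time_ne_top _ hu)).1
  · by_cases hu : u ∈ M.playedStates B i z
    · rw [peel_time_of_mem _ hu]
      exact_mod_cast (mem_Icc.1 (firstTime_spec hu).1).1
    · simp [peel_time_of_notMem _ hu]
  · have hu := mem_of_peel_time_ne_top _ hu
    rw [peel_time_of_mem _ hu]
    exact_mod_cast (mem_Icc.1 (firstTime_spec hu).1).2
  · by_cases hu : u ∈ M.playedStates B i z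
    · obtain ⟨hv, h1, -⟩ := hz.parent_mem huv hu
      rw [peel_time_of_mem _ hu, peel_time_of_mem _ hv]
      exact_mod_cast h1
    · simp [peel_time_of_notMem _ hu]
  · by_cases hu : u ∈ M.playedStates B i z
    · rw [peel_time_of_mem _ hu, peel_prob_of_mem _ hu, peel_prob_of_mem _ hr, M.pathProb_root]
      simp
    · simp [peel_time_of_notMem _ hu, peel_prob_of_notMem _ hu]
  · rw [peel_prob_of_mem _ hr]
    exact mul_nonneg (hz.eps_pos _).le (M.pathProb_nonneg _)

lemma peel_prob_nonneg (u : S) : 0 ≤ (M.peel B i z hA).prob u := by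
  by_cases hu : u ∈ M.playedStates B i z
  · rw [peel_prob_of_mem _ hu]
    exact mul_nonneg (hz.eps_pos _).le (M.pathProb_nonneg _)
  · rw [peel_prob_of_notMem _ hu]

lemma peel_prob_le {u : S} {t : ℕ} (ht : (M.peel B i z hA).time u = t) :
    (M.peel B i z hA).prob u ≤ z u t := by
  have hu : u ∈ M.playedStates B i z := mem_of_peel_time_ne_top hA (by simp [ht])
  rw [peel_time_of_mem _ hu] at ht
  rw [peel_prob_of_mem _ hu, ← Nat.cast_injective ht, ← le_div_iff₀ (hz.pathProb_pos hu)]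
  exact inf'_le _ hu

omit hz in
lemma sum_residual {F : Forest S} (hF : ∀ u, 1 ≤ F.time u) (u : S) (t : ℕ) :
    ∑ t' ∈ Icc 1 t, M.residual z F u t' =
      ∑ t' ∈ Icc 1 t, z u t' - if F.time u ≤ t then F.prob u else 0 := by
  have h1 (t' : ℕ) : M.residual z F u t' =
      z u t' - if F.time u = (t' : ℕ∞) then F.prob u else 0 := by
    unfold residual
    split_ifs <;> simp
  simp only [h1, sum_sub_distrib]
  congr 1
  by_cases hT : F.time u = ⊤
  · simp [hT]
  · obtain ⟨s, hs⟩ := ENat.ne_top_iff_exists.1 hT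
    have h1 := hF u
    rw [← hs] at h1 ⊢
    have h1' : 1 ≤ s := by exact_mod_cast h1
    simp only [Nat.cast_inj, Nat.cast_le, sum_ite_eq, mem_Icc, h1', true_and]

/-- If `u` is peeled by time `t + 1`, then its parent is peeled by time `t`, and both sides of the
prefix inequality drop by the same `ε * pathProb u`. Otherwise `u` has no mass up to `t + 1` and the
left side vanishes. -/
lemma isResidual_residual : M.IsResidual B i (M.residual z (M.peel B i z hA)) := by
  have hF := hz.isStrategyForest_peel hA
  have hnn : ∀ u, M.arm u = i → ∀ t ∈ Icc 1 B, 0 ≤ M.residual z (M.peel B i z hA) u t := by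
    intro u hu t ht
    unfold residual
    split_ifs with h
    · exact sub_nonneg.2 (hz.peel_prob_le hA h)
    · exact hz.nonneg u hu t ht
  refine ⟨hnn, fun u v huv hu t ht => ?_⟩
  have hv : M.arm v = i := by rw [← M.arm_parent u v huv, hu]
  have hR : 0 ≤ M.p v u * ∑ t' ∈ Icc 1 t, M.residual z (M.peel B i z hA) v t' := by
    refine mul_nonneg (M.p_nonneg _ _) (sum_nonneg fun s hs => hnn v hv s ?_)
    rw [mem_Icc] at hs ⊢
    omega
  by_cases hle : (M.peel B i z hA).time u ≤ (t + 1 : ℕ)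
  · have hu' : u ∈ M.playedStates B i z :=
      mem_of_peel_time_ne_top hA (hle.trans_lt (ENat.natCast_lt_top _)).ne
    obtain ⟨hv', h1, -⟩ := hz.parent_mem huv hu'
    have hle' : (M.peel B i z hA).time v ≤ t := by
      rw [peel_time_of_mem _ hu'] at hle
      rw [peel_time_of_mem _ hv']
      have : M.firstTime B z u ≤ t + 1 := by exact_mod_cast hle
      exact_mod_cast (by omega : M.firstTime B z v ≤ t)
    rw [sum_residual hF.one_le, sum_residual hF.one_le, if_pos hle, if_pos hle',
      peel_prob_of_mem _ hu', peel_prob_of_mem _ hv', M.pathProb_of_parent huv]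
    have := hz.le_parent u v huv hu t ht
    linarith
  · rw [sum_residual hF.one_le, if_neg hle, sub_zero]
    refine le_trans (le_of_eq (sum_eq_zero fun s hs => ?_)) hR
    rw [mem_Icc] at hs
    have hsB : s ∈ Icc 1 B := mem_Icc.2 (by omega)
    by_cases hu' : u ∈ M.playedStates B i z
    · by_contra h0
      have := firstTime_le (M := M) hsB (lt_of_le_of_ne (hz.nonneg u hu s hsB) (Ne.symm h0))
      rw [peel_time_of_mem _ hu'] at hle
      exact hle (by exact_mod_cast (by omega : M.firstTime B z u ≤ t + 1))
    · exact hz.eq_zero_of_notMem hu hu' hsB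

end IsResidual

/-- The positive entries of `z`. -/
def support (B : ℕ) (z : S → ℕ → ℝ) : Finset (S × ℕ) :=
  {x ∈ univ ×ˢ Icc 1 B | 0 < z x.1 x.2}

lemma card_support_le : (support B z).card ≤ Fintype.card S * B := by
  refine (card_filter_le _ _).trans (le_of_eq ?_)
  simp

/-- The state attaining the minimum that defines `ε` loses its whole mass at its first time. -/
lemma IsResidual.card_support_residual_lt (hz : M.IsResidual B i z)
    (hA : (M.playedStates B i z).Nonempty) :
    (support B (M.residual z (M.peel B i z hA))).card < (support B z).card := by
  refine card_lt_card ((ssubset_iff_of_subset fun x hx => ?_).2 ?_)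
  · simp only [support, mem_filter] at hx ⊢
    refine ⟨hx.1, hx.2.trans_le ?_⟩
    unfold residual
    split_ifs
    · exact sub_le_self _ (hz.peel_prob_nonneg hA _)
    · rfl
  · obtain ⟨u, hu, hmin⟩ := exists_mem_eq_inf' hA
      (fun v => z v (M.firstTime B z v) / M.pathProb v)
    obtain ⟨h1, h2⟩ := firstTime_spec hu
    refine ⟨(u, M.firstTime B z u), ?_, ?_⟩
    · simp only [support, mem_filter, mem_product, mem_univ, true_and]
      exact ⟨h1, h2⟩
    · simp only [support, mem_filter, not_and]
      intro _
      rw [residual, if_pos (IsResidual.peel_time_of_mem hA hu), IsResidual.peel_prob_of_mem hA hu,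
        hmin, div_mul_cancel₀ _ (hz.pathProb_pos hu).ne', sub_self]
      exact lt_irrefl 0

lemma IsResidual.isStrategyForest_of_mem_decompose {k : ℕ} {F : Forest S}
    (hz : M.IsResidual B i z) (hF : F ∈ M.decompose B i k z) : M.IsStrategyForest B i F := by
  induction k generalizing z with
  | zero => simp [decompose] at hF
  | succ k ih =>
    rw [decompose] at hF
    split_ifs at hF with hA
    · rcases List.mem_cons.1 hF with rfl | hF
      · exact hz.isStrategyForest_peel hA
      · exact ih (hz.isResidual_residual hA) hF
    · simp at hF

/-- Any iteration count bounding the number of positive entries suffices, because each round removes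
one. When no played state is left, nothing of `z` remains on the arm. -/
lemma IsResidual.sum_decompose {k : ℕ} (hz : M.IsResidual B i z) (hk : (support B z).card ≤ k)
    {u : S} (hu : M.arm u = i) {t : ℕ} (ht : t ∈ Icc 1 B) :
    ((M.decompose B i k z).map fun F => if F.time u = (t : ℕ∞) then F.prob u else 0).sum =
      z u t := by
  induction k generalizing z with
  | zero =>
    have h0 : support B z = ∅ := card_eq_zero.1 (by omega)
    have h1 : (u, t) ∉ support B z := by simp [h0]
    simp only [support, mem_filter, mem_product, mem_univ, true_and, ht, not_lt] at h1
    simp [decompose, le_antisymm h1 (hz.nonneg u hu t ht)]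
  | succ k ih =>
    rw [decompose]
    split_ifs with hA
    · have := hz.card_support_residual_lt hA
      rw [List.map_cons, List.sum_cons, ih (hz.isResidual_residual hA) (by omega), residual]
      split_ifs <;> ring
    · have : u ∉ M.playedStates B i z := fun h => hA ⟨u, h⟩
      simp [hz.eq_zero_of_notMem hu this ht]

lemma LPFeasible.isStrategyForest_of_mem_phaseI {w : S → ℕ → ℝ} {F : Forest S}
    (h : M.LPFeasible B z w) (hF : F ∈ M.phaseI B z i) : M.IsStrategyForest B i F :=
  (h.isResidual i).isStrategyForest_of_mem_decompose hF

lemma LPFeasible.sum_phaseI {w : S → ℕ → ℝ} (h : M.LPFeasible B z w)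
    {u : S} (hu : M.arm u = i) {t : ℕ} (ht : t ∈ Icc 1 B) :
    ((M.phaseI B z i).map fun F => if F.time u = (t : ℕ∞) then F.prob u else 0).sum = z u t :=
  (h.isResidual i).sum_decompose card_support_le hu ht

end

section

variable {n : ℕ} {S : Type*} [Fintype S] (M : TreeMAB n S)

/-! ### Gap filling -/

/-- The forest `F` arises from `F₀` by playing some states earlier, where only states `u` with
`F₀.time u < 2 * depth u` are moved. -/
structure IsAdvancement (F₀ F : Forest S) : Prop where
  prob_eq : F.prob = F₀.prob
  time_le : ∀ u, F.time u ≤ F₀.time u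
  eq_top : ∀ u, F.time u = ⊤ → F₀.time u = ⊤
  one_le : ∀ u, 1 ≤ F.time u
  succ_le : ∀ u v, M.parent u = some v → F.time v + 1 ≤ F.time u
  lt_of_ne : ∀ u, F.time u ≠ F₀.time u → F₀.time u < (2 * M.depth u : ℕ)

variable {M}

lemma IsStrategyForest.isAdvancement {B : ℕ} {i : Fin n} {F : Forest S}
    (h : M.IsStrategyForest B i F) : M.IsAdvancement F F :=
  ⟨rfl, fun _ => le_rfl, fun _ => id, h.one_le, h.succ_le, fun _ h => absurd rfl h⟩

lemma IsStrategyForest.of_isAdvancement {B : ℕ} {i : Fin n} {F₀ F : Forest S}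
    (h₀ : M.IsStrategyForest B i F₀) (h : M.IsAdvancement F₀ F) : M.IsStrategyForest B i F := by
  have htop (u : S) (hu : F.time u ≠ ⊤) : F₀.time u ≠ ⊤ := by
    intro h0
    by_cases hne : F.time u = F₀.time u
    · exact hu (hne.trans h0)
    · have := h.lt_of_ne u hne
      simp [h0] at this
  refine ⟨fun u hu => h₀.arm_eq u (htop u hu), h.one_le,
    fun u hu => (h.time_le u).trans (h₀.le_of_ne_top u (htop u hu)), h.succ_le, fun u => ?_, ?_⟩
  · rw [h.prob_eq, h₀.prob_eq u]
    by_cases hu : F.time u = ⊤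
    · rw [if_pos hu, if_pos (h.eq_top u hu)]
    · rw [if_neg hu, if_neg (htop u hu)]
  · rw [h.prob_eq]
    exact h₀.prob_root_nonneg

lemma InComp.time_eq {F : Forest S} {v u : S} (h : M.InComp F v u) :
    M.depth v ≤ M.depth u ∧ F.time u = F.time v + ((M.depth u - M.depth v : ℕ) : ℕ∞) := by
  induction h with
  | refl => simp
  | @tail b c _ hbc ih =>
    have hd := M.depth_parent _ _ hbc.1
    have h1 : M.depth c - M.depth v = (M.depth b - M.depth v) + 1 := by omega
    refine ⟨by omega, ?_⟩
    rw [hbc.2.2, ih.2, h1, Nat.cast_add, Nat.cast_one, add_assoc]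

lemma advance_time_of_inComp {F : Forest S} {v v' u : S} (h : M.InComp F v u) :
    (M.advance F v v').time u = F.time v' + 1 + ((M.depth u - M.depth v : ℕ) : ℕ∞) := if_pos h

lemma advance_time_of_not_inComp {F : Forest S} {v v' u : S} (h : ¬ M.InComp F v u) :
    (M.advance F v v').time u = F.time u := if_neg h

/-! ### Advancing one component, and termination of gap filling -/

section Advance

variable {F₀ F : Forest S} {τ : ℕ} {v v' : S}

lemma GapAt.not_inComp_parent (hg : M.GapAt τ F v v') : ¬ M.InComp F v v' := by
  intro h
  have h1 := h.time_eq.1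
  have h2 := M.depth_parent _ _ hg.2.1
  omega

lemma IsAdvancement.advance (h : M.IsAdvancement F₀ F) (hg : M.GapAt τ F v v') :
    M.IsAdvancement F₀ (M.advance F v v') := by
  have hv' := h.succ_le v v' hg.2.1
  have hfin : F.time v' ≠ ⊤ := by
    intro h0
    rw [h0, hg.2.2.1] at hv'
    simp at hv'
  have hle (u : S) : (M.advance F v v').time u ≤ F.time u := by
    by_cases hu : M.InComp F v u
    · rw [advance_time_of_inComp hu, hu.time_eq.2]
      gcongr
    · rw [advance_time_of_not_inComp hu]
  refine ⟨h.prob_eq, fun u => (hle u).trans (h.time_le u), fun u hu => ?_, fun u => ?_,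
    fun u w huw => ?_, fun u hu => ?_⟩
  · by_cases hc : M.InComp F v u
    · rw [advance_time_of_inComp hc] at hu
      simp [hfin] at hu
    · rw [advance_time_of_not_inComp hc] at hu
      exact h.eq_top u hu
  · by_cases hc : M.InComp F v u
    · rw [advance_time_of_inComp hc, add_assoc, add_comm, add_assoc]
      exact le_self_add
    · rw [advance_time_of_not_inComp hc]
      exact h.one_le u
  · by_cases hc : M.InComp F v u
    · rcases Relation.ReflTransGen.cases_tail hc with rfl | ⟨b, hb, hbu⟩
      · obtain rfl : v' = w := by
          have := hg.2.1.symm.trans huw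
          simpa using this
        rw [advance_time_of_inComp hc, advance_time_of_not_inComp hg.not_inComp_parent]
        simp
      · obtain rfl : b = w := by
          have := hbu.1.symm.trans huw
          simpa using this
        have hd := M.depth_parent _ _ huw
        have h1 : M.depth u - M.depth v = (M.depth b - M.depth v) + 1 := by
          have := (InComp.time_eq hb).1
          omega
        rw [advance_time_of_inComp hc, advance_time_of_inComp hb, h1, Nat.cast_add, Nat.cast_one]
        rw [← add_assoc]
    · rw [advance_time_of_not_inComp hc]
      exact (add_le_add_left (hle w) 1).trans (h.succ_le u w huw)
  -- Only a first move has to be checked. A state of the component then had original time `τ +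
  -- (depth u - depth v)`, which is below `2 * depth u` because `τ < 2 * depth v`.
  · by_cases hne : F.time u = F₀.time u
    · rw [← hne] at hu ⊢
      have hc : M.InComp F v u := by
        by_contra hc
        exact hu (advance_time_of_not_inComp hc)
      obtain ⟨h1, h2⟩ := hc.time_eq
      rw [h2, hg.2.2.1]
      have := hg.2.2.2
      exact_mod_cast (by omega : τ + (M.depth u - M.depth v) < 2 * M.depth u)
    · exact h.lt_of_ne u hne

/-- Advancing creates no head: inside the component every state becomes or stays contiguous with its
parent, and a contiguous edge ending outside also starts outside, so neither end moves. -/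
lemma GapAt.isHead_of_advance (hg : M.GapAt τ F v v') (hfin : F.time v' ≠ ⊤) {w : S}
    (hw : M.IsHead (M.advance F v v') w) :
    w ≠ v ∧ M.IsHead F w ∧ (M.advance F v v').time w = F.time w := by
  have hc : ¬ M.InComp F v w := by
    intro hc
    rcases Relation.ReflTransGen.cases_tail hc with rfl | ⟨b, hb, hbw⟩
    · refine hw v' ⟨hg.2.1, ?_, ?_⟩
      · rw [advance_time_of_inComp hc]
        simp [hfin]
      · rw [advance_time_of_inComp hc, advance_time_of_not_inComp hg.not_inComp_parent]
        simp
    · have hd := M.depth_parent _ _ hbw.1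
      have h1 : M.depth w - M.depth v = (M.depth b - M.depth v) + 1 := by
        have := (InComp.time_eq hb).1
        omega
      refine hw b ⟨hbw.1, ?_, ?_⟩
      · rw [advance_time_of_inComp hc]
        simp [hfin]
      · rw [advance_time_of_inComp hc, advance_time_of_inComp hb, h1, Nat.cast_add, Nat.cast_one,
          ← add_assoc]
  refine ⟨?_, fun u hu => ?_, advance_time_of_not_inComp hc⟩
  · rintro rfl
    exact hc .refl
  · have hcu : ¬ M.InComp F v u := fun hcu => hc (hcu.tail hu)
    refine hw u ⟨hu.1, ?_, ?_⟩
    · rw [advance_time_of_not_inComp hc]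
      exact hu.2.1
    · rw [advance_time_of_not_inComp hc, advance_time_of_not_inComp hcu]
      exact hu.2.2

variable (M) in
/-- The heads that have a gap at time `τ`. -/
def gaps (τ : ℕ) (F : Forest S) : Finset S := {v | ∃ v', M.GapAt τ F v v'}

lemma IsAdvancement.gapStep (h : M.IsAdvancement F₀ F) (τ : ℕ) :
    M.IsAdvancement F₀ (M.gapStep τ F) := by
  unfold TreeMAB.gapStep
  split_ifs with hg
  · exact h.advance hg.choose_spec.choose_spec
  · exact h

lemma IsAdvancement.gaps_advance_subset (h : M.IsAdvancement F₀ F) (hg : M.GapAt τ F v v')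
    (σ : ℕ) : M.gaps σ (M.advance F v v') ⊆ (M.gaps σ F).erase v := by
  have hfin : F.time v' ≠ ⊤ := by
    intro h0
    have hv' := h.succ_le v v' hg.2.1
    rw [h0, hg.2.2.1] at hv'
    simp at hv'
  intro w hw
  simp only [gaps, mem_filter, mem_univ, true_and, mem_erase] at hw ⊢
  obtain ⟨w', hw'⟩ := hw
  obtain ⟨h1, h2, h3⟩ := hg.isHead_of_advance hfin hw'.1
  exact ⟨h1, w', h2, hw'.2.1, h3 ▸ hw'.2.2.1, hw'.2.2.2⟩

lemma IsAdvancement.gaps_gapStep_subset (h : M.IsAdvancement F₀ F) (τ σ : ℕ) :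
    M.gaps σ (M.gapStep τ F) ⊆ M.gaps σ F := by
  unfold TreeMAB.gapStep
  split_ifs with hg
  · exact (h.gaps_advance_subset hg.choose_spec.choose_spec σ).trans (erase_subset _ _)
  · rfl

lemma IsAdvancement.card_gaps_gapStep_le (h : M.IsAdvancement F₀ F) (τ : ℕ) :
    (M.gaps τ (M.gapStep τ F)).card ≤ (M.gaps τ F).card - 1 := by
  unfold TreeMAB.gapStep
  split_ifs with hg
  · refine (card_le_card (h.gaps_advance_subset hg.choose_spec.choose_spec τ)).trans ?_
    rw [card_erase_of_mem]
    simpa [gaps] using ⟨_, hg.choose_spec.choose_spec⟩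
  · have : M.gaps τ F = ∅ := by
      simp only [gaps, filter_eq_empty_iff, mem_univ, true_imp_iff]
      exact fun v hv => hg ⟨v, hv⟩
    simp [this]

lemma IsAdvancement.iterate_gapStep (h : M.IsAdvancement F₀ F) (τ k : ℕ) :
    M.IsAdvancement F₀ ((M.gapStep τ)^[k] F) ∧
      (∀ σ, M.gaps σ ((M.gapStep τ)^[k] F) ⊆ M.gaps σ F) ∧
      (M.gaps τ ((M.gapStep τ)^[k] F)).card ≤ (M.gaps τ F).card - k := by
  induction k with
  | zero => exact ⟨h, fun _ => subset_rfl, by simp⟩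
  | succ k ih =>
    obtain ⟨h1, h2, h3⟩ := ih
    rw [Function.iterate_succ_apply']
    refine ⟨h1.gapStep τ, fun σ => (h1.gaps_gapStep_subset τ σ).trans (h2 σ), ?_⟩
    have := h1.card_gaps_gapStep_le τ
    omega

/-- Gap sets never grow, at any time, so times already processed stay free of gaps. Each step at `τ`
removes a gap if one exists, so `card S` steps suffice. -/
lemma IsAdvancement.gapFill (h : M.IsAdvancement F₀ F) (k : ℕ) :
    M.IsAdvancement F₀ (M.gapFill k F) ∧ (∀ σ, M.gaps σ (M.gapFill k F) ⊆ M.gaps σ F) ∧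
      ∀ σ ∈ Icc 1 k, M.gaps σ (M.gapFill k F) = ∅ := by
  induction k generalizing F with
  | zero => exact ⟨h, fun _ => subset_rfl, by simp⟩
  | succ k ih =>
    obtain ⟨h1, h2, h3⟩ := h.iterate_gapStep (k + 1) (Fintype.card S)
    obtain ⟨h4, h5, h6⟩ := ih h1
    refine ⟨h4, fun σ => (h5 σ).trans (h2 σ), fun σ hσ => ?_⟩
    rw [mem_Icc] at hσ
    by_cases hk : σ = k + 1
    · subst hk
      have h0 : M.gaps (k + 1) ((M.gapStep (k + 1))^[Fintype.card S] F) = ∅ := by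
        rw [← card_eq_zero]
        have := card_le_univ (M.gaps (k + 1) F)
        omega
      exact subset_empty.1 (h0 ▸ h5 (k + 1))
    · exact h6 σ (mem_Icc.2 (by omega))

end Advance

lemma IsStrategyForest.isAdvancement_gapFill {B : ℕ} {i : Fin n} {F : Forest S}
    (h : M.IsStrategyForest B i F) : M.IsAdvancement F (M.gapFill B F) :=
  (h.isAdvancement.gapFill B).1

/-- After gap filling, every state belongs to a contiguous run of plays, whose first state `v`
is not played before time `2 * depth v`. -/
lemma IsStrategyForest.exists_head {B : ℕ} {i : Fin n} {F : Forest S}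
    (h : M.IsStrategyForest B i F) {u : S} (hu : (M.gapFill B F).time u ≠ ⊤) :
    ∃ v, M.pathProb v * M.reach v u = M.pathProb u ∧
      (M.gapFill B F).time v + ((M.depth u - M.depth v : ℕ) : ℕ∞) = (M.gapFill B F).time u ∧
      ((2 * M.depth v : ℕ) : ℕ∞) ≤ (M.gapFill B F).time v ∧ M.depth v ≤ M.depth u := by
  obtain ⟨h1, -, h2⟩ := h.isAdvancement.gapFill B
  have h3 := h.of_isAdvancement h1
  set G := M.gapFill B F
  have hself (u : S) (hd : ((2 * M.depth u : ℕ) : ℕ∞) ≤ G.time u) :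
      ∃ v, M.pathProb v * M.reach v u = M.pathProb u ∧
        G.time v + ((M.depth u - M.depth v : ℕ) : ℕ∞) = G.time u ∧
        ((2 * M.depth v : ℕ) : ℕ∞) ≤ G.time v ∧ M.depth v ≤ M.depth u :=
    ⟨u, by simp [M.reach_self], by simp, hd, le_rfl⟩
  induction u using M.tree_induction with
  | root u hp =>
    refine hself u ?_
    rw [M.eq_root_of_parent_eq_none hp, M.depth_root]
    simp
  | child u w hw ih =>
    have hsucc := h3.succ_le u w hw
    have hd := M.depth_parent _ _ hw
    -- A state contiguous with its parent inherits the head of the parent. Otherwise it is a head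
    -- itself, and a time below `2 * depth u` would be a surviving gap.
    by_cases hc : G.time u = G.time w + 1
    · have hwt : G.time w ≠ ⊤ := by
        rintro h0
        rw [h0] at hsucc
        simp at hsucc
        exact hu hsucc
      obtain ⟨v, hv1, hv2, hv3, hv4⟩ := ih hwt
      refine ⟨v, ?_, ?_, hv3, by omega⟩
      · rw [M.reach_of_parent _ hw, ← mul_assoc, hv1, M.pathProb_of_parent hw]
        rintro rfl
        omega
      · have : M.depth u - M.depth v = (M.depth w - M.depth v) + 1 := by omega
        rw [hc, ← hv2, this, Nat.cast_add, Nat.cast_one, add_assoc]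
    · refine hself u ?_
      obtain ⟨τ, hτ⟩ := ENat.ne_top_iff_exists.1 hu
      have hτ1 := h3.one_le u
      have hτB := h3.le_of_ne_top u hu
      rw [← hτ] at hτ1 hτB ⊢
      have hmem : τ ∈ Icc 1 B := mem_Icc.2 ⟨by exact_mod_cast hτ1, by exact_mod_cast hτB⟩
      by_contra hlt
      have hlt' : τ < 2 * M.depth u := by
        rw [not_le] at hlt
        exact_mod_cast hlt
      have : u ∈ M.gaps τ G := by
        simp only [gaps, mem_filter, mem_univ, true_and]
        refine ⟨w, fun w' hw' => ?_, hw, hτ.symm, hlt'⟩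
        obtain rfl : w = w' := by
          have := hw.symm.trans hw'.1
          simpa using this
        exact hc hw'.2.2
      rw [h2 τ hmem] at this
      simp at this

end

section

variable {n : ℕ} {S : Type*} [Fintype S] (M : TreeMAB n S)

/-! ### The load of the advanced forests -/

/-- Induction along the tree: from children to parents. -/
lemma tree_induction_down {motive : S → Prop}
    (h : ∀ u, (∀ v, M.parent v = some u → motive v) → motive u) (u : S) : motive u := by
  induction hd : univ.sup M.depth - M.depth u using Nat.strong_induction_on generalizing u with
  | _ d ih =>
    refine h u fun v hv => ih _ ?_ v rfl
    have h1 := M.depth_parent v u hv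
    have h2 : M.depth v ≤ univ.sup M.depth := le_sup (mem_univ v)
    omega

lemma reach_eq_zero_of_depth_le {x y : S} (hxy : x ≠ y) (h : M.depth y ≤ M.depth x) :
    M.reach x y = 0 := by
  rcases hp : M.parent y with _ | v
  · exact M.reach_of_parent_eq_none hxy hp
  · rw [M.reach_of_parent hxy hp]
    by_contra h0
    have h1 := M.depth_le_of_reach_ne_zero (left_ne_zero_of_mul h0)
    have h2 := M.depth_parent y v hp
    omega

lemma reach_eq_add {x y v : S} (hy : M.parent y = some v) :
    M.reach x y = (if x = y then 1 else 0) + M.reach x v * M.p v y := by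
  by_cases hxy : x = y
  · have h1 := M.depth_parent y v hy
    rw [hxy, M.reach_self, if_pos rfl, M.reach_eq_zero_of_depth_le _ (by omega)]
    · ring
    · rintro rfl
      omega
  · rw [if_neg hxy, zero_add, M.reach_of_parent hxy hy]

/-- A path hits every level set of a function increasing along the edges at most once. -/
lemma sum_reach_le_one {f : S → ℕ∞} (hf : ∀ u v, M.parent u = some v → f v + 1 ≤ f u) (s : ℕ)
    (y : S) : (∑ x, if f x = s then M.reach y x else 0) ≤ 1 := by
  induction y using M.tree_induction_down with
  | h y ih =>
    by_cases hy : f y = s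
    · rw [sum_eq_single y]
      · rw [if_pos hy, reach_self]
      · intro x _ hx
        split_ifs with hxs
        · by_contra h0
          obtain ⟨-, h2⟩ := M.le_of_reach_ne_zero hf h0
          have h3 : ¬ M.depth x ≤ M.depth y := fun h =>
            h0 (M.reach_eq_zero_of_depth_le (Ne.symm hx) h)
          rw [hy, hxs] at h2
          have : s + (M.depth x - M.depth y) ≤ s := by exact_mod_cast h2
          omega
        · rfl
      · simp
    · calc (∑ x, if f x = s then M.reach y x else 0)
          = ∑ x, ∑ c, M.p y c * (if f x = s then M.reach c x else 0) := by
            refine sum_congr rfl fun x _ => ?_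
            split_ifs with hx
            · exact M.reach_eq_sum fun h => hy (h ▸ hx)
            · simp
        _ = ∑ c, M.p y c * ∑ x, (if f x = s then M.reach c x else 0) := by
            rw [sum_comm]
            simp only [mul_sum]
        _ ≤ ∑ c, M.p y c * 1 := by
            refine sum_le_sum fun c _ => ?_
            by_cases hc : M.p y c = 0
            · simp [hc]
            · exact mul_le_mul_of_nonneg_left (ih c (parent_of_p_ne_zero hc)) (M.p_nonneg _ _)
        _ ≤ 1 := by simpa using M.sum_p_le_one y

/-- The probability that the forest `F`, once chosen, plays at time `s`. -/
def playMass (F : Forest S) (s : ℕ) : ℝ := ∑ x, if F.time x = s then M.pathProb x else 0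

lemma sum_playMass {F : Forest S} (hF : ∀ u, 1 ≤ F.time u) (s : ℕ) :
    ∑ t ∈ Icc 1 s, M.playMass F t = ∑ x, if F.time x ≤ s then M.pathProb x else 0 := by
  unfold playMass
  rw [sum_comm]
  refine sum_congr rfl fun x _ => ?_
  by_cases hx : F.time x = ⊤
  · simp [hx]
  · obtain ⟨τ, hτ⟩ := ENat.ne_top_iff_exists.1 hx
    have h1 := hF x
    rw [← hτ] at h1 ⊢
    have h1' : 1 ≤ τ := by exact_mod_cast h1
    simp only [Nat.cast_inj, Nat.cast_le, sum_ite_eq, mem_Icc, h1', true_and]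

/-- The number of states on the path to `x` with `f`-value at most `s`, times `pathProb x`. -/
def pathCount (f : S → ℕ∞) (s : ℕ) (x : S) : ℝ :=
  ∑ y, if f y ≤ s then M.pathProb y * M.reach y x else 0

lemma pathCount_of_parent (f : S → ℕ∞) (s : ℕ) {x v : S} (hx : M.parent x = some v) :
    M.pathCount f s x =
      (if f x ≤ s then M.pathProb x else 0) + M.pathCount f s v * M.p v x := by
  have h1 (y : S) : (if f y ≤ s then M.pathProb y * M.reach y x else 0) =
      (if y = x then (if f x ≤ s then M.pathProb x else 0) else 0) +
        (if f y ≤ s then M.pathProb y * M.reach y v else 0) * M.p v x := by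
    rw [M.reach_eq_add hx]
    by_cases hyx : y = x
    · subst hyx
      split_ifs <;> ring
    · simp only [if_neg hyx]
      split_ifs <;> ring
  simp only [pathCount, h1, sum_add_distrib, sum_ite_eq', mem_univ, if_true, sum_mul]

lemma pathCount_nonneg (f : S → ℕ∞) (s : ℕ) (x : S) : 0 ≤ M.pathCount f s x :=
  sum_nonneg fun y _ => by
    split_ifs
    · exact mul_nonneg (M.pathProb_nonneg _) (M.reach_nonneg _ _)
    · rfl

/-- Labels increase along edges, so all `depth x + 1` states on the path to `x` are counted. -/
lemma pathCount_of_le {f : S → ℕ∞} (hf : ∀ u v, M.parent u = some v → f v + 1 ≤ f u) {s : ℕ}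
    {x : S} (hx : f x ≤ s) : M.pathCount f s x = (M.depth x + 1) * M.pathProb x := by
  induction x using M.tree_induction with
  | root x hp =>
    rw [pathCount, sum_eq_single x]
    · rw [if_pos hx, reach_self, M.eq_root_of_parent_eq_none hp, M.depth_root]
      simp
    · intro y _ hy
      rw [M.reach_of_parent_eq_none hy hp]
      simp
    · simp
  | child x v hp ih =>
    have hv : f v ≤ s := le_self_add.trans ((hf x v hp).trans hx)
    rw [M.pathCount_of_parent _ _ hp, if_pos hx, ih hv, M.depth_parent x v hp,
      M.pathProb_of_parent hp]
    push_cast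
    ring

variable {M}

/-- Climb from `x` until the parent `v` was originally scheduled by time `s`. The state just below
`v` was moved across `s`, so `s < 2 * (depth v + 1)`, which is twice the number of states on the
path to `v`. The climb ends before the root, since a root is never moved. -/
lemma IsAdvancement.le_two_mul_pathCount {F₀ F : Forest S} (h : M.IsAdvancement F₀ F)
    (h₀ : ∀ u v, M.parent u = some v → F₀.time v + 1 ≤ F₀.time u) {s : ℕ} {x : S}
    (hx : F.time x ≤ s) (hx₀ : s < F₀.time x) :
    s * M.pathProb x ≤ 2 * M.pathCount F₀.time s x := by
  induction x using M.tree_induction with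
  | root x hp =>
    have := h.lt_of_ne x (hx.trans_lt hx₀).ne
    rw [M.eq_root_of_parent_eq_none hp, M.depth_root] at this
    simp at this
  | child x v hp ih =>
    have h1 : s < 2 * M.depth x := by
      exact_mod_cast hx₀.trans (h.lt_of_ne x (hx.trans_lt hx₀).ne)
    rw [M.pathCount_of_parent _ _ hp, if_neg (not_le.2 hx₀), zero_add, M.pathProb_of_parent hp]
    by_cases hv₀ : F₀.time v ≤ s
    · rw [M.pathCount_of_le h₀ hv₀, ← mul_assoc, ← mul_assoc, ← mul_assoc]
      refine mul_le_mul_of_nonneg_right ?_ (M.p_nonneg _ _)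
      refine mul_le_mul_of_nonneg_right ?_ (M.pathProb_nonneg _)
      rw [M.depth_parent x v hp] at h1
      exact_mod_cast h1.le
    · have := ih (le_self_add.trans ((h.succ_le x v hp).trans hx)) (not_le.1 hv₀)
      rw [← mul_assoc, ← mul_assoc]
      exact mul_le_mul_of_nonneg_right this (M.p_nonneg _ _)

/-- Advancing the states of a forest increases its load in a controlled way. -/
lemma IsAdvancement.mul_playMass_le {F₀ F : Forest S} (h : M.IsAdvancement F₀ F)
    (h₀ : ∀ u v, M.parent u = some v → F₀.time v + 1 ≤ F₀.time u) (h₁ : ∀ u, 1 ≤ F₀.time u)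
    (s : ℕ) : s * M.playMass F s ≤
      s * M.playMass F₀ s + 2 * ∑ t ∈ Icc 1 s, M.playMass F₀ t := by
  -- Double counting: from a fixed `y`, the states of new time `s` are reached with total
  -- probability at most one, as a path meets that level set at most once.
  have hsum : (∑ x, if F.time x = s then M.pathCount F₀.time s x else 0) ≤
      ∑ t ∈ Icc 1 s, M.playMass F₀ t := by
    rw [M.sum_playMass h₁]
    calc (∑ x, if F.time x = s then M.pathCount F₀.time s x else 0)
        = ∑ y, (if F₀.time y ≤ s then M.pathProb y else 0) *
            ∑ x, if F.time x = s then M.reach y x else 0 := by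
          simp only [mul_sum]
          rw [sum_comm]
          refine sum_congr rfl fun x _ => ?_
          split_ifs
          · exact sum_congr rfl fun y _ => by split_ifs <;> simp
          · simp
      _ ≤ ∑ y, (if F₀.time y ≤ s then M.pathProb y else 0) * 1 := by
          refine sum_le_sum fun y _ => mul_le_mul_of_nonneg_left (M.sum_reach_le_one h.succ_le s y) ?_
          split_ifs
          · exact M.pathProb_nonneg _
          · rfl
      _ = _ := by simp
  refine le_trans ?_ (add_le_add_right (mul_le_mul_of_nonneg_left hsum zero_le_two) _)
  unfold playMass
  rw [mul_sum, mul_sum, mul_sum, ← sum_add_distrib]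
  refine sum_le_sum fun x _ => ?_
  by_cases hx : F.time x = s
  · rw [if_pos hx, if_pos hx]
    by_cases hx₀ : F₀.time x = s
    · rw [if_pos hx₀]
      exact le_add_of_nonneg_right (mul_nonneg zero_le_two (M.pathCount_nonneg _ _ _))
    · rw [if_neg hx₀, mul_zero, zero_add]
      exact h.le_two_mul_pathCount h₀ hx.le
        (lt_of_le_of_ne (hx ▸ h.time_le x) (Ne.symm hx₀))
  · simp only [if_neg hx, mul_zero, add_zero]
    split_ifs
    · exact mul_nonneg (Nat.cast_nonneg _) (M.pathProb_nonneg _)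
    · simp

/-! ### Loads and rewards summed over the forests of all arms -/

variable {B : ℕ} {z w : S → ℕ → ℝ}

lemma sum_get {α : Type*} (L : List α) (f : α → ℝ) :
    ∑ j, f (L.get j) = (L.map f).sum := by
  rw [← Fin.sum_univ_fun_getElem]
  rfl

lemma sum_forests (M : TreeMAB n S) (B : ℕ) (z : S → ℕ → ℝ) (i : Fin n) (f : Forest S → ℝ) :
    ∑ j, f ((M.forests B z i).get j) = ∑ j, f (M.gapFill B ((M.phaseI B z i).get j)) := by
  rw [sum_get, sum_get _ fun F => f (M.gapFill B F), forests, List.map_map]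
  rfl

namespace LPFeasible

variable (h : M.LPFeasible B z w)
include h

lemma isStrategyForest_get (i : Fin n) (j : Fin (M.phaseI B z i).length) :
    M.IsStrategyForest B i ((M.phaseI B z i).get j) :=
  h.isStrategyForest_of_mem_phaseI (List.get_mem _ _)

lemma isStrategyForest_forests_get (i : Fin n) (j : Fin (M.forests B z i).length) :
    ∃ F₀, M.IsStrategyForest B i F₀ ∧ (M.forests B z i).get j = M.gapFill B F₀ := by
  obtain ⟨F₀, h₀, h₁⟩ := List.mem_map.1 (List.get_mem (M.forests B z i) j)
  exact ⟨F₀, h.isStrategyForest_of_mem_phaseI h₀, h₁.symm⟩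

lemma sum_phaseI_get {i : Fin n} {u : S} (hu : M.arm u = i) {t : ℕ} (ht : t ∈ Icc 1 B) :
    (∑ j, if ((M.phaseI B z i).get j).time u = (t : ℕ∞) then ((M.phaseI B z i).get j).prob u
      else 0) = z u t := by
  exact (sum_get _ fun F : Forest S => if F.time u = (t : ℕ∞) then F.prob u else 0).trans
    (h.sum_phaseI hu ht)

omit h in
lemma _root_.TreeMAB.IsStrategyForest.prob_eq_sum {i : Fin n} {F : Forest S}
    (hF : M.IsStrategyForest B i F) (u : S) :
    F.prob u = ∑ t ∈ Icc 1 B, if F.time u = (t : ℕ∞) then F.prob u else 0 := by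
  by_cases hu : F.time u = ⊤
  · rw [hF.prob_eq]
    simp [hu]
  · have h1 := hF.one_le u
    have h2 := hF.le_of_ne_top u hu
    obtain ⟨τ, hτ⟩ := ENat.ne_top_iff_exists.1 hu
    rw [← hτ] at h1 h2 ⊢
    have h1' : 1 ≤ τ := by exact_mod_cast h1
    have h2' : τ ≤ B := by exact_mod_cast h2
    simp only [Nat.cast_inj, sum_ite_eq, mem_Icc, h1', h2', true_and, if_true]

lemma sum_prob {i : Fin n} {u : S} (hu : M.arm u = i) :
    ∑ j, ((M.phaseI B z i).get j).prob u = ∑ t ∈ Icc 1 B, z u t := by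
  rw [sum_congr rfl fun j _ => (h.isStrategyForest_get i j).prob_eq_sum u, sum_comm]
  exact sum_congr rfl fun t ht => h.sum_phaseI_get hu ht

lemma sum_prob_root_le_one (i : Fin n) :
    ∑ j, ((M.phaseI B z i).get j).prob (M.root i) ≤ 1 := by
  rw [h.sum_prob (M.arm_root i)]
  rcases Nat.eq_zero_or_pos B with rfl | hB
  · simp
  · refine (h.z_le_w _ B (mem_Icc.2 ⟨hB, le_rfl⟩)).trans (le_of_eq ?_)
    rw [sum_eq_single 1, h.w_root_one]
    · intro t ht ht1
      rw [mem_Icc] at ht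
      exact h.w_root i t (mem_Icc.2 (by omega))
    · exact fun h1 => absurd (mem_Icc.2 ⟨le_rfl, hB⟩) h1

lemma sum_playMass_phaseI_le (s : ℕ) :
    ∑ i, ∑ j, ((M.phaseI B z i).get j).prob (M.root i) *
      M.playMass ((M.phaseI B z i).get j) s ≤ 1 := by
  have h1 (i : Fin n) (j : Fin (M.phaseI B z i).length) :
      ((M.phaseI B z i).get j).prob (M.root i) * M.playMass ((M.phaseI B z i).get j) s =
        ∑ x, if ((M.phaseI B z i).get j).time x = (s : ℕ∞) then
          ((M.phaseI B z i).get j).prob x else 0 := by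
    rw [playMass, mul_sum]
    refine sum_congr rfl fun x _ => ?_
    split_ifs with hx
    · rw [(h.isStrategyForest_get i j).prob_eq x, if_neg (hx ▸ ENat.natCast_ne_top s)]
    · simp
  simp only [h1]
  by_cases hs : s ∈ Icc 1 B
  · have h2 (i : Fin n) (x : S) :
        (∑ j, if ((M.phaseI B z i).get j).time x = (s : ℕ∞) then
          ((M.phaseI B z i).get j).prob x else 0) = if M.arm x = i then z x s else 0 := by
      split_ifs with hx
      · exact h.sum_phaseI_get hx hs
      · refine sum_eq_zero fun j _ => if_neg fun hj => hx ?_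
        exact (h.isStrategyForest_get i j).arm_eq x (hj ▸ ENat.natCast_ne_top s)
    rw [sum_congr rfl fun i _ => sum_comm]
    simp only [h2]
    rw [sum_comm]
    simpa using h.z_load s hs
  · refine le_trans (le_of_eq (sum_eq_zero fun i _ => sum_eq_zero fun j _ =>
      sum_eq_zero fun x _ => if_neg fun hj => hs ?_)) zero_le_one
    have h3 := (h.isStrategyForest_get i j).one_le x
    have h4 := (h.isStrategyForest_get i j).le_of_ne_top x (hj ▸ ENat.natCast_ne_top s)
    rw [hj] at h3 h4
    exact mem_Icc.2 ⟨by exact_mod_cast h3, by exact_mod_cast h4⟩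

/-- The bound 3 is 1 from the original load at time `s`, plus twice the average original load over
the times `1, …, s`. -/
lemma sum_playMass_forests_le {s : ℕ} (hs : 1 ≤ s) :
    ∑ i, ∑ j, ((M.forests B z i).get j).prob (M.root i) *
      M.playMass ((M.forests B z i).get j) s ≤ 3 := by
  have hs' : (0 : ℝ) < s := by exact_mod_cast hs
  refine le_of_mul_le_mul_left ?_ hs'
  simp only [fun i => sum_forests M B z i fun F => F.prob (M.root i) * M.playMass F s]
  have h1 (i : Fin n) (j : Fin (M.phaseI B z i).length) :
      s * ((M.gapFill B ((M.phaseI B z i).get j)).prob (M.root i) *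
        M.playMass (M.gapFill B ((M.phaseI B z i).get j)) s) ≤
      s * (((M.phaseI B z i).get j).prob (M.root i) * M.playMass ((M.phaseI B z i).get j) s) +
        2 * ∑ t ∈ Icc 1 s, ((M.phaseI B z i).get j).prob (M.root i) *
          M.playMass ((M.phaseI B z i).get j) t := by
    have hF := h.isStrategyForest_get i j
    have h2 := hF.isAdvancement_gapFill
    have h3 := mul_le_mul_of_nonneg_left (h2.mul_playMass_le hF.succ_le hF.one_le s)
      hF.prob_root_nonneg
    rw [h2.prob_eq, ← mul_sum]
    linarith
  calc _ = ∑ i, ∑ j, s * ((M.gapFill B ((M.phaseI B z i).get j)).prob (M.root i) *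
        M.playMass (M.gapFill B ((M.phaseI B z i).get j)) s) := by simp only [mul_sum]
    _ ≤ _ := sum_le_sum fun i _ => sum_le_sum fun j _ => h1 i j
    _ = s * (∑ i, ∑ j, ((M.phaseI B z i).get j).prob (M.root i) *
          M.playMass ((M.phaseI B z i).get j) s) +
        2 * ∑ t ∈ Icc 1 s, ∑ i, ∑ j, ((M.phaseI B z i).get j).prob (M.root i) *
          M.playMass ((M.phaseI B z i).get j) t := by
        rw [sum_comm (s := Icc 1 s), sum_congr rfl fun i _ => sum_comm (s := Icc 1 s)]
        simp only [sum_add_distrib, mul_sum]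
    _ ≤ s * 1 + 2 * ∑ t ∈ Icc 1 s, 1 := by
        gcongr
        · exact h.sum_playMass_phaseI_le s
        · exact h.sum_playMass_phaseI_le _
    _ = s * 3 := by
        simp
        ring

/-- The total probability of playing at one of the times `1, …, s`. -/
lemma sum_time_le_forests_le (s : ℕ) :
    (∑ i, ∑ j, ((M.forests B z i).get j).prob (M.root i) *
      ∑ x, if ((M.forests B z i).get j).time x ≤ s then M.pathProb x else 0) ≤ 3 * s := by
  have h1 (i : Fin n) (j : Fin (M.forests B z i).length) :
      (∑ x, if ((M.forests B z i).get j).time x ≤ s then M.pathProb x else 0) =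
        ∑ t ∈ Icc 1 s, M.playMass ((M.forests B z i).get j) t := by
    obtain ⟨F₀, h₀, h₁⟩ := h.isStrategyForest_forests_get i j
    rw [sum_playMass]
    rw [h₁]
    exact h₀.isAdvancement_gapFill.one_le
  simp only [h1, mul_sum]
  rw [sum_congr rfl fun i _ => sum_comm, sum_comm]
  refine (sum_le_sum fun t ht => h.sum_playMass_forests_le (mem_Icc.1 ht).1).trans ?_
  simp [mul_comm]

/-- Gap filling changes neither the probabilities nor the set of states of finite time, so the
rewards are those of the decomposition, which sums to `z`. -/
lemma sum_reward_forests :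
    (∑ i, ∑ j, ((M.forests B z i).get j).prob (M.root i) *
      ∑ u, if ((M.forests B z i).get j).time u = ⊤ then 0 else M.r u * M.pathProb u) =
        M.lpValue B z := by
  simp only [fun i => sum_forests M B z i fun F => F.prob (M.root i) *
    ∑ u, if F.time u = ⊤ then 0 else M.r u * M.pathProb u]
  have h1 (i : Fin n) (j : Fin (M.phaseI B z i).length) :
      ((M.gapFill B ((M.phaseI B z i).get j)).prob (M.root i) *
        ∑ u, if (M.gapFill B ((M.phaseI B z i).get j)).time u = ⊤ then 0
          else M.r u * M.pathProb u) = ∑ u, M.r u * ((M.phaseI B z i).get j).prob u := by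
    have hF := h.isStrategyForest_get i j
    have h2 := hF.isAdvancement_gapFill
    rw [mul_sum]
    refine sum_congr rfl fun u _ => ?_
    rw [← h2.prob_eq, (hF.of_isAdvancement h2).prob_eq u]
    split_ifs <;> ring
  have h2 (i : Fin n) (u : S) : ∑ j, M.r u * ((M.phaseI B z i).get j).prob u =
      if M.arm u = i then M.r u * ∑ t ∈ Icc 1 B, z u t else 0 := by
    rw [← mul_sum]
    split_ifs with hu
    · rw [h.sum_prob hu]
    · rw [sum_eq_zero, mul_zero]
      intro j _
      have hF := h.isStrategyForest_get i j
      rw [hF.prob_eq, if_pos]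
      by_contra h0
      exact hu (hF.arm_eq u h0)
  simp only [h1]
  rw [sum_congr rfl fun i _ => sum_comm]
  simp only [h2]
  rw [sum_comm, lpValue]
  simp [mul_sum]

lemma sampleProb_nonneg (i : Fin n) (o : M.Choice B z i) : 0 ≤ M.sampleProb B z i o := by
  have h1 (j : Fin (M.forests B z i).length) : 0 ≤ ((M.forests B z i).get j).prob (M.root i) := by
    obtain ⟨F₀, h₀, h₁⟩ := h.isStrategyForest_forests_get i j
    rw [h₁]
    exact (h₀.of_isAdvancement h₀.isAdvancement_gapFill).prob_root_nonneg
  rcases o with _ | j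
  · have h2 : ∑ j, ((M.forests B z i).get j).prob (M.root i) ≤ 1 := by
      rw [sum_forests M B z i fun F => F.prob (M.root i)]
      refine le_of_eq_of_le (sum_congr rfl fun j _ => ?_) (h.sum_prob_root_le_one i)
      rw [(h.isStrategyForest_get i j).isAdvancement_gapFill.prob_eq]
    simp only [sampleProb, ← sum_div]
    linarith
  · exact div_nonneg (h1 j) (by norm_num)

end LPFeasible

end

section

variable {n : ℕ} {S : Type*} [Fintype S] (M : TreeMAB n S)

/-! ### Scheduling -/

lemma sum_le_expNext (x : S) {f : Option S → ℝ} (hf : ∀ s, 0 ≤ f s) :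
    ∑ v, M.p x v * f (some v) ≤ M.expNext x f := by
  unfold expNext
  split_ifs with hx
  · simpa [hx.p_eq_zero] using hf none
  · rfl

/-- The expected number of plays, at times up to `s` of the forest, that remain to be made by an
arm in state `x`. -/
def pending (s : ℕ) (G : Option (Forest S)) (x : Option S) : ℝ :=
  match G, x with
  | some F, some x => ∑ y, if F.time y ≤ s then M.reach x y else 0
  | _, _ => 0

lemma pending_nonneg (s : ℕ) (G : Option (Forest S)) (x : Option S) : 0 ≤ M.pending s G x := by
  rcases G with _ | F <;> rcases x with _ | x <;> simp only [pending, le_refl]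
  exact sum_nonneg fun y _ => by split_ifs <;> simp [M.reach_nonneg]

/-- The play of `x` itself is counted in its own pending number; by the first-step decomposition of
`reach`, what remains is the expectation after the transition. -/
lemma expNext_pending {s : ℕ} {F : Forest S} {x : S} (hx : F.time x ≤ s) :
    M.expNext x (M.pending s (some F)) = M.pending s (some F) (some x) - 1 := by
  rw [expNext_eq_sum _ (by rfl)]
  have h1 (y : S) : M.reach x y = (if x = y then 1 else 0) + ∑ v, M.p x v * M.reach v y := by
    by_cases hxy : x = y
    · subst hxy
      rw [if_pos rfl, reach_self, sum_eq_zero, add_zero]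
      intro v _
      by_cases hv : M.p x v = 0
      · simp [hv]
      · have hd := depth_of_p_ne_zero hv
        rw [M.reach_eq_zero_of_depth_le _ (by omega), mul_zero]
        rintro rfl
        omega
    · rw [if_neg hxy, zero_add, M.reach_eq_sum hxy]
  have h2 : M.pending s (some F) (some x) =
      ∑ y, ((if x = y then 1 else 0) + ∑ v, M.p x v * if F.time y ≤ s then M.reach v y else 0) := by
    refine sum_congr rfl fun y _ => ?_
    split_ifs with hy hxy hxy
    · rw [h1, if_pos hxy]
    · rw [h1, if_neg hxy]
    · exact absurd (hxy ▸ hx) hy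
    · simp
  rw [h2, sum_add_distrib, sum_comm]
  simp [pending, mul_sum]

variable {M} {T : Fin n → Option (Forest S)}

lemma nextTime_eq {h : M.History} {i : Fin n} {F : Forest S} {x : S} (hT : T i = some F)
    (hx : M.curr h i = some x) : M.nextTime T h i = F.time x := by
  simp [nextTime, hT, hx]

lemma exists_of_nextTime_ne_top {h : M.History} {i : Fin n} (hi : M.nextTime T h i ≠ ⊤) :
    ∃ F x, T i = some F ∧ M.curr h i = some x ∧ M.nextTime T h i = F.time x := by
  rcases hT : T i with _ | F
  · simp [nextTime, hT] at hi
  · rcases hx : M.curr h i with _ | x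
    · simp [nextTime, hT, hx] at hi
    · exact ⟨F, x, rfl, rfl, nextTime_eq hT hx⟩

lemma earliest_spec {h : M.History} {j : Fin n} (hj : M.earliest T h = some j) :
    M.nextTime T h j ≠ ⊤ ∧ ∀ i, M.nextTime T h j ≤ M.nextTime T h i := by
  simpa using List.find?_some hj

lemma exists_earliest {h : M.History} {i : Fin n} (hi : M.nextTime T h i ≠ ⊤) :
    ∃ j, M.earliest T h = some j := by
  rw [← Option.isSome_iff_exists, earliest, List.find?_isSome]
  obtain ⟨j, -, hj⟩ := exists_min_image univ (M.nextTime T h) ⟨i, mem_univ i⟩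
  refine ⟨j, List.mem_finRange j, ?_⟩
  simp only [decide_eq_true_eq]
  exact ⟨((hj i (mem_univ i)).trans_lt (lt_top_iff_ne_top.2 hi)).ne, fun k => hj k (mem_univ k)⟩

lemma exists_schedule {h : M.History} {i : Fin n} (hi : M.nextTime T h i ≠ ⊤) :
    ∃ j, M.schedule T h = some j := by
  rcases h with _ | ⟨⟨j, s⟩, h⟩
  · exact exists_earliest hi
  · rw [schedule]
    split_ifs
    · exact ⟨j, rfl⟩
    · exact exists_earliest hi

/-- A scheduled arm either continues the run of the last pull, or is the earliest one. -/
lemma schedule_spec {h : M.History} {j : Fin n} (hj : M.schedule T h = some j) :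
    M.nextTime T h j ≠ ⊤ ∧ ((∃ s h', h = (j, s) :: h' ∧
      M.nextTime T h j = M.nextTime T h' j + 1) ∨ ∀ i, M.nextTime T h j ≤ M.nextTime T h i) := by
  rcases h with _ | ⟨⟨i, s⟩, h⟩
  · exact ⟨(earliest_spec hj).1, Or.inr (earliest_spec hj).2⟩
  · rw [schedule] at hj
    split_ifs at hj with hc
    · obtain rfl : i = j := by simpa using hj
      exact ⟨hc.1, Or.inl ⟨s, h, rfl, hc.2⟩⟩
    · exact ⟨(earliest_spec hj).1, Or.inr (earliest_spec hj).2⟩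

/-! ### The progress of one arm under the scheduler -/

section Arm

variable {i : Fin n} {F : Forest S} (hT : T i = some F)
  (hF : ∀ u v, M.parent u = some v → F.time v + 1 ≤ F.time u)
include hT hF

/-- Once the scheduler plays a state of a contiguous run, it follows the run to its end. -/
lemma reach_le_visits_of_contiguous {u : S} (hu : F.time u ≠ ⊤) {k : ℕ} {h : M.History} {x : S}
    (hs : M.schedule T h = some i) (hx : M.curr h i = some x)
    (hxu : F.time x + ((M.depth u - M.depth x : ℕ) : ℕ∞) = F.time u)
    (hk : M.depth u - M.depth x < k) : M.reach x u ≤ M.visits (M.schedule T) u k h := by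
  induction k generalizing h x with
  | zero => omega
  | succ k ih =>
    rw [visits_succ, step_of_curr hs hx]
    by_cases hne : x = u
    · rw [if_pos hne, hne, reach_self]
      exact le_add_of_nonneg_right (expNext_nonneg fun s => M.visits_nonneg _ _ _ _)
    · rw [if_neg hne, zero_add, M.reach_eq_sum hne]
      refine le_trans (sum_le_sum fun s _ => ?_)
        (M.sum_le_expNext x fun s => M.visits_nonneg _ _ _ _)
      by_cases hp : M.p x s = 0
      · simp [hp]
      refine mul_le_mul_of_nonneg_left ?_ (M.p_nonneg _ _)
      by_cases hr : M.reach s u = 0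
      · rw [hr]
        exact M.visits_nonneg _ _ _ _
      obtain ⟨h1, h2⟩ := M.le_of_reach_ne_zero hF hr
      have h3 := depth_of_p_ne_zero hp
      have h4 := hF s x (parent_of_p_ne_zero hp)
      have hst : F.time s ≠ ⊤ := fun h0 => hu (by simpa [h0] using h2)
      have hxt : F.time x ≠ ⊤ := fun h0 => hst (by simpa [h0] using h4)
      obtain ⟨a, ha⟩ := ENat.ne_top_iff_exists.1 hst
      obtain ⟨b, hb⟩ := ENat.ne_top_iff_exists.1 hxt
      obtain ⟨c, hc⟩ := ENat.ne_top_iff_exists.1 hu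
      rw [← ha, ← hc] at h2
      rw [← hb, ← hc] at hxu
      rw [← ha, ← hb] at h4
      have h2' : a + (M.depth u - M.depth s) ≤ c := by exact_mod_cast h2
      have hxu' : b + (M.depth u - M.depth x) = c := by exact_mod_cast hxu
      have h4' : b + 1 ≤ a := by exact_mod_cast h4
      have hcurr : M.curr ((i, some s) :: h) i = some s := by simp [curr]
      refine ih ?_ hcurr ?_ (by omega)
      -- The path from `s` to `u` needs at least one time unit per edge, and the total time from `x`
      -- to `u` is exactly the number of edges. So no edge has slack, and the scheduler stays on
      -- this arm.
      · rw [schedule, if_pos]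
        rw [nextTime_eq hT hcurr, nextTime_eq hT hx]
        refine ⟨hst, ?_⟩
        rw [← ha, ← hb]
        exact_mod_cast (by omega : a = b + 1)
      · rw [← ha, ← hc]
        exact_mod_cast (by omega : a + (M.depth u - M.depth s) = c)

omit hT hF in
lemma sum_pending_cons_self (s : ℕ) (h : M.History) (x : Option S) :
    ∑ i' ∈ univ.erase i, M.pending s (T i') (M.curr ((i, x) :: h) i') =
      ∑ i' ∈ univ.erase i, M.pending s (T i') (M.curr h i') :=
  sum_congr rfl fun i' hi' => by rw [curr, if_neg (ne_of_mem_erase hi').symm]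

omit hT hF in
lemma sum_pending_cons_of_ne (s : ℕ) (h : M.History) {j : Fin n} (hj : j ≠ i) (x : Option S) :
    ∑ i' ∈ univ.erase i, M.pending s (T i') (M.curr ((j, x) :: h) i') =
      (∑ i' ∈ univ.erase i, M.pending s (T i') (M.curr h i') - M.pending s (T j) (M.curr h j)) +
        M.pending s (T j) x := by
  have hmem : j ∈ univ.erase i := mem_erase.2 ⟨hj, mem_univ j⟩
  rw [← add_sum_erase _ _ hmem, ← add_sum_erase _ (fun i' => M.pending s (T i') (M.curr h i')) hmem]
  have h1 : ∑ i' ∈ (univ.erase i).erase j, M.pending s (T i') (M.curr ((j, x) :: h) i') =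
      ∑ i' ∈ (univ.erase i).erase j, M.pending s (T i') (M.curr h i') :=
    sum_congr rfl fun i' hi' => by rw [curr, if_neg (ne_of_mem_erase hi').symm]
  rw [h1, curr, if_pos rfl]
  ring

/-- The head `v` of a contiguous run, with time `t`, is likely to be played by time `t`, unless
the other arms are expected to make many plays. Here `c` counts the pulls of other arms. -/
lemma reach_mul_le_visits {B t : ℕ} {u v : S} (hv : F.time v = t)
    (hvu : F.time v + ((M.depth u - M.depth v : ℕ) : ℕ∞) = F.time u) (huB : F.time u ≤ B)
    (ht : 1 ≤ t) (hvt : 2 * M.depth v ≤ t) {k c : ℕ} {h : M.History} {x : S}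
    (hk : k + c + M.depth x = B) (hx : M.curr h i = some x)
    (hinv : ∀ j s h', h = (j, s) :: h' → j ≠ i → M.nextTime T h' j + 1 ≤ (t + c : ℕ)) :
    M.reach x v * M.reach v u * (1 - 2 / t * (c +
      ∑ i' ∈ univ.erase i, M.pending (2 * t - 1) (T i') (M.curr h i'))) ≤
        M.visits (M.schedule T) u k h := by
  have ht' : (0 : ℝ) < t := by exact_mod_cast ht
  have hvuB : t + (M.depth u - M.depth v) ≤ B := by
    rw [← hvu, hv] at huB
    exact_mod_cast huB
  have hut : F.time u ≠ ⊤ := (huB.trans_lt (ENat.natCast_lt_top B)).ne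
  have hW₀ (h : M.History) :
      0 ≤ ∑ i' ∈ univ.erase i, M.pending (2 * t - 1) (T i') (M.curr h i') :=
    sum_nonneg fun i' _ => M.pending_nonneg _ _ _
  -- If `v` is unreachable or `2 * c ≥ t`, the claimed lower bound is at most zero. This is where
  -- the truncation in Markov's inequality happens.
  have hreduce {k c : ℕ} {h : M.History} {x : S}
      (H : M.reach x v ≠ 0 → 2 * c < t → M.reach x v * M.reach v u * (1 - 2 / t * (c +
        ∑ i' ∈ univ.erase i, M.pending (2 * t - 1) (T i') (M.curr h i'))) ≤
          M.visits (M.schedule T) u k h) :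
      M.reach x v * M.reach v u * (1 - 2 / t * (c +
        ∑ i' ∈ univ.erase i, M.pending (2 * t - 1) (T i') (M.curr h i'))) ≤
          M.visits (M.schedule T) u k h := by
    by_cases hr : M.reach x v = 0
    · rw [hr, zero_mul, zero_mul]
      exact M.visits_nonneg _ _ _ _
    by_cases hc : 2 * c < t
    · exact H hr hc
    refine le_trans (mul_nonpos_of_nonneg_of_nonpos
      (mul_nonneg (M.reach_nonneg _ _) (M.reach_nonneg _ _)) ?_) (M.visits_nonneg _ _ _ _)
    have hc' : (t : ℝ) ≤ 2 * c := by exact_mod_cast not_lt.1 hc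
    rw [sub_nonpos, div_mul_eq_mul_div, le_div_iff₀ ht']
    linarith [hW₀ h]
  induction k generalizing c h x with
  | zero =>
    -- Running out of pulls is impossible: `depth x ≤ depth v ≤ t / 2` and `c < t / 2` give fewer
    -- than `t ≤ B` pulls so far.
    refine hreduce fun hr hc => ?_
    have := M.depth_le_of_reach_ne_zero hr
    omega
  | succ k ih =>
    refine hreduce fun hr hc => ?_
    obtain ⟨hd, hxv⟩ := M.le_of_reach_ne_zero hF hr
    have hxt : F.time x ≤ t := hv ▸ le_self_add.trans hxv
    have hnx : M.nextTime T h i = F.time x := nextTime_eq hT hx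
    obtain ⟨j, hj⟩ := exists_schedule (T := T) (h := h) (i := i)
      (hnx ▸ (hxt.trans_lt (ENat.natCast_lt_top t)).ne)
    have hK : 0 ≤ M.reach x v * M.reach v u := mul_nonneg (M.reach_nonneg _ _) (M.reach_nonneg _ _)
    by_cases hji : j = i
    · subst hji
      by_cases hne : x = v
      · subst hne
        -- Fewer than `t` pulls precede this play of `v`, so more than `B - t` pulls remain, enough
        -- to follow the run to `u`.
        refine le_trans ?_ (reach_le_visits_of_contiguous hT hF hut hj hx hvu (by omega))
        rw [reach_self, one_mul]
        refine mul_le_of_le_one_right (M.reach_nonneg _ _) (sub_le_self _ ?_)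
        exact mul_nonneg (by positivity) (add_nonneg (Nat.cast_nonneg _) (hW₀ h))
      · rw [visits_succ, step_of_curr hj hx, M.reach_eq_sum hne, sum_mul, sum_mul]
        refine le_add_of_nonneg_of_le (by split_ifs <;> simp) ?_
        refine le_trans (sum_le_sum fun s _ => ?_)
          (M.sum_le_expNext x fun s => M.visits_nonneg _ _ _ _)
        by_cases hp : M.p x s = 0
        · simp [hp]
        rw [mul_assoc, mul_assoc, ← mul_assoc (M.reach s v)]
        refine mul_le_mul_of_nonneg_left ?_ (M.p_nonneg _ _)
        have h3 := depth_of_p_ne_zero hp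
        have := ih (c := c) (h := (j, some s) :: h) (x := s) (by omega) (by simp [curr]) (by
          intro j' s' h' hh hj'
          simp only [List.cons.injEq, Prod.mk.injEq] at hh
          exact absurd hh.1.1.symm hj')
        rwa [sum_pending_cons_self] at this
    · obtain ⟨hjt, hjs⟩ := schedule_spec hj
      obtain ⟨G, y, hG, hy, hny⟩ := exists_of_nextTime_ne_top hjt
      have hyc : M.nextTime T h j ≤ (t + c : ℕ) := by
        -- Either `j` continues its run, whose time exceeds `t` by at most the number of pulls of
        -- other arms, or `j` is no later than arm `i`, which is due by time `t`.
        rcases hjs with ⟨s, h', hh, he⟩ | hle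
        · rw [he]
          exact hinv j s h' hh hji
        · exact ((hle i).trans (hnx.trans_le hxt)).trans (by exact_mod_cast Nat.le_add_right t c)
      have hys : G.time y ≤ (2 * t - 1 : ℕ) := by
        rw [← hny]
        exact hyc.trans (by exact_mod_cast (by omega : t + c ≤ 2 * t - 1))
      rw [visits_succ, step_of_curr hj hy]
      refine le_add_of_nonneg_of_le (by split_ifs <;> simp) ?_
      have hstep (s : Option S) := ih (c := c + 1) (h := (j, s) :: h) (x := x) (by omega)
        (by rw [curr, if_neg hji, hx]) (by
          intro j' s' h' hh _
          simp only [List.cons.injEq, Prod.mk.injEq] at hh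
          rw [← hh.1.1, ← hh.2, ← add_assoc, Nat.cast_add (t + c) 1]
          exact add_le_add_left hyc 1)
      simp only [sum_pending_cons_of_ne _ _ hji] at hstep
      -- The inductive bound is affine in the pending number of `j` after the pull. Its expectation
      -- drops by exactly one while `c` grows by one, so the potential is preserved.
      refine le_trans ?_ (expNext_mono (f := fun s => M.reach x v * M.reach v u * (1 - 2 / t *
        ((c + 1 : ℕ) + (∑ i' ∈ univ.erase i, M.pending (2 * t - 1) (T i') (M.curr h i') -
          M.pending (2 * t - 1) (T j) (M.curr h j)))) +
        -(M.reach x v * M.reach v u * (2 / t)) * M.pending (2 * t - 1) (T j) s)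
        (le_trans (le_of_eq ?_) (hstep none)) fun s _ => le_trans (le_of_eq ?_) (hstep (some s)))
      · rw [expNext_add, expNext_const, expNext_mul, hG, hy, M.expNext_pending hys]
        refine le_of_eq ?_
        push_cast
        ring
      · ring
      · ring

end Arm

end

/-! ### Averaging over the choices of the arms -/

section Product

variable {ι : Type*} [Fintype ι] [DecidableEq ι] {α : ι → Type*} [∀ i, Fintype (α i)]

/-- Absorb `f` into the factor at `a` and expand the product of sums. -/
lemma sum_prod_mul (P : ∀ i, α i → ℝ) (a : ι) (f : α a → ℝ) :
    ∑ σ : ∀ i, α i, (∏ i, P i (σ i)) * f (σ a) =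
      (∑ o, P a o * f o) * ∏ i ∈ univ.erase a, ∑ o, P i o := by
  have h1 := (prod_univ_sum (fun i => (univ : Finset (α i)))
    (Function.update P a fun o => P a o * f o)).symm
  rw [Fintype.piFinset_univ] at h1
  have h2 (σ : ∀ i, α i) : ∏ i, Function.update P a (fun o => P a o * f o) i (σ i) =
      (∏ i, P i (σ i)) * f (σ a) := by
    rw [← mul_prod_erase univ _ (mem_univ a), ← mul_prod_erase univ (fun i => P i (σ i))
      (mem_univ a), Function.update_self, prod_congr rfl fun i hi => by
        rw [Function.update_of_ne (ne_of_mem_erase hi)]]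
    ring
  rw [sum_congr rfl fun σ _ => (h2 σ).symm, h1, ← mul_prod_erase univ _ (mem_univ a),
    Function.update_self]
  congr 1
  exact prod_congr rfl fun i hi => by rw [Function.update_of_ne (ne_of_mem_erase hi)]

variable {P : ∀ i, α i → ℝ} (hP : ∀ i, ∑ o, P i o = 1)
include hP

lemma sum_prod_mul_eq (a : ι) (f : α a → ℝ) :
    ∑ σ : ∀ i, α i, (∏ i, P i (σ i)) * f (σ a) = ∑ o, P a o * f o := by
  rw [sum_prod_mul, prod_congr rfl fun i _ => hP i, prod_const_one, mul_one]

/-- Independence of two coordinates, obtained by absorbing `g` into the weight at `b` first; this is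
why `sum_prod_mul` allows weights not summing to one. -/
lemma sum_prod_mul_mul_eq {a b : ι} (hab : a ≠ b) (f : α a → ℝ) (g : α b → ℝ) :
    ∑ σ : ∀ i, α i, (∏ i, P i (σ i)) * (f (σ a) * g (σ b)) =
      (∑ o, P a o * f o) * ∑ o, P b o * g o := by
  have h1 := sum_prod_mul (Function.update P b fun o => P b o * g o) a f
  have h2 (σ : ∀ i, α i) : ∏ i, Function.update P b (fun o => P b o * g o) i (σ i) =
      (∏ i, P i (σ i)) * g (σ b) := by
    rw [← mul_prod_erase univ _ (mem_univ b), ← mul_prod_erase univ (fun i => P i (σ i))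
      (mem_univ b), Function.update_self, prod_congr rfl fun i hi => by
        rw [Function.update_of_ne (ne_of_mem_erase hi)]]
    ring
  have hb : b ∈ univ.erase a := mem_erase.2 ⟨hab.symm, mem_univ b⟩
  simp only [h2, Function.update_of_ne hab] at h1
  rw [← mul_prod_erase _ _ hb, Function.update_self, prod_eq_one, mul_one] at h1
  · rw [← h1]
    exact sum_congr rfl fun σ _ => by ring
  · intro i hi
    rw [Function.update_of_ne (ne_of_mem_erase hi), hP]

end Product

/-! ### Expected reward of the randomized algorithm -/

variable {n : ℕ} {S : Type*} [Fintype S] {M : TreeMAB n S} {B : ℕ} {z w : S → ℕ → ℝ}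

lemma sum_sampleProb (M : TreeMAB n S) (B : ℕ) (z : S → ℕ → ℝ) (i : Fin n) :
    ∑ o, M.sampleProb B z i o = 1 := by
  rw [Fintype.sum_option]
  simp [sampleProb]

lemma sum_sampleProb_mul (M : TreeMAB n S) (B : ℕ) (z : S → ℕ → ℝ) (i : Fin n)
    (f : M.Choice B z i → ℝ) (hf : f none = 0) :
    ∑ o, M.sampleProb B z i o * f o =
      (∑ j, ((M.forests B z i).get j).prob (M.root i) * f (some j)) / 24 := by
  rw [Fintype.sum_option, hf, mul_zero, zero_add, sum_div]
  exact sum_congr rfl fun j _ => by simp only [sampleProb]; ring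

lemma algReward_eq_sum (M : TreeMAB n S) (B : ℕ) (z : S → ℕ → ℝ) :
    M.algReward B z = ∑ u, M.r u * ∑ σ : ∀ i, M.Choice B z i, (∏ i, M.sampleProb B z i (σ i)) *
      M.visits (M.schedule fun i => (σ i).map (M.forests B z i).get) u B [] := by
  simp only [algReward, reward, rewardFrom_eq_sum_visits, mul_sum]
  rw [sum_comm]
  exact sum_congr rfl fun u _ => sum_congr rfl fun σ _ => by ring

namespace LPFeasible

variable (h : M.LPFeasible B z w)
include h

/-- If arm `i` chooses the forest `j`, then a state `u` of finite time is played unless the other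
arms make many plays before twice the time `t` of the head of its run. -/
lemma exists_le_visits (i : Fin n) (j : Fin (M.forests B z i).length) {u : S}
    (hu : ((M.forests B z i).get j).time u ≠ ⊤) :
    ∃ t : ℕ, 1 ≤ t ∧ ∀ T : Fin n → Option (Forest S), T i = some ((M.forests B z i).get j) →
      M.pathProb u * (1 - 2 / t * ∑ i' ∈ univ.erase i,
        M.pending (2 * t - 1) (T i') (some (M.root i'))) ≤ M.visits (M.schedule T) u B [] := by
  obtain ⟨F₀, h₀, h₁⟩ := h.isStrategyForest_forests_get i j
  rw [h₁] at hu ⊢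
  have hF := h₀.of_isAdvancement h₀.isAdvancement_gapFill
  obtain ⟨v, hv1, hv2, hv3, hv4⟩ := h₀.exists_head hu
  have hvt : (M.gapFill B F₀).time v ≠ ⊤ := fun h0 => hu (by rw [← hv2, h0, top_add])
  obtain ⟨t, ht⟩ := ENat.ne_top_iff_exists.1 hvt
  have ht1 := hF.one_le v
  rw [← ht] at ht1 hv3
  refine ⟨t, by exact_mod_cast ht1, fun T hT => ?_⟩
  have := reach_mul_le_visits hT hF.succ_le ht.symm hv2 (hF.le_of_ne_top u hu)
    (by exact_mod_cast ht1) (by exact_mod_cast hv3) (k := B) (c := 0) (h := []) (x := M.root i)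
    (by rw [M.depth_root]; rfl) rfl (by simp)
  rwa [M.reach_root (hF.arm_eq v hvt), hv1, Nat.cast_zero, zero_add] at this

/-- Load at most 3 per time unit, scaled by the sampling factor: `3 / 24 = 1 / 8`. -/
lemma sum_pending_root_le (i : Fin n) (s : ℕ) :
    ∑ i' ∈ univ.erase i, ∑ o, M.sampleProb B z i' o *
      M.pending s (o.map (M.forests B z i').get) (some (M.root i')) ≤ s / 8 := by
  have h1 (i' : Fin n) (j : Fin (M.forests B z i').length) :
      M.pending s ((some j).map (M.forests B z i').get) (some (M.root i')) =
        ∑ x, if ((M.forests B z i').get j).time x ≤ s then M.pathProb x else 0 := by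
    obtain ⟨F₀, h₀, h₁⟩ := h.isStrategyForest_forests_get i' j
    have hF := h₀.of_isAdvancement h₀.isAdvancement_gapFill
    rw [← h₁] at hF
    refine sum_congr rfl fun x _ => ?_
    split_ifs with hx
    · exact M.reach_root (hF.arm_eq x (hx.trans_lt (ENat.natCast_lt_top s)).ne)
    · rfl
  calc _ ≤ ∑ i', ∑ o, M.sampleProb B z i' o *
        M.pending s (o.map (M.forests B z i').get) (some (M.root i')) :=
        sum_le_sum_of_subset_of_nonneg (subset_univ _) fun i' _ _ => sum_nonneg fun o _ =>
          mul_nonneg (h.sampleProb_nonneg i' o) (M.pending_nonneg _ _ _)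
    _ = (∑ i', ∑ j, ((M.forests B z i').get j).prob (M.root i') *
          ∑ x, if ((M.forests B z i').get j).time x ≤ s then M.pathProb x else 0) / 24 := by
        rw [sum_div]
        refine sum_congr rfl fun i' _ => ?_
        rw [sum_sampleProb_mul _ _ _ _ _ (by rfl)]
        simp only [h1]
    _ ≤ 3 * s / 24 := by
        gcongr
        exact h.sum_time_le_forests_le s
    _ = s / 8 := by ring

/-- With the probability of choosing a forest, a state of finite time in it is played with at
least half the probability of its path. -/
lemma half_le_sum_visits (i : Fin n) (j : Fin (M.forests B z i).length) {u : S}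
    (hu : ((M.forests B z i).get j).time u ≠ ⊤) :
    M.sampleProb B z i (some j) * (M.pathProb u / 2) ≤
      ∑ σ : ∀ i, M.Choice B z i, (∏ i, M.sampleProb B z i (σ i)) *
        ((if σ i = some j then 1 else 0) *
          M.visits (M.schedule fun i => (σ i).map (M.forests B z i).get) u B []) := by
  obtain ⟨t, ht, hle⟩ := h.exists_le_visits i j hu
  have ht' : (0 : ℝ) < t := by exact_mod_cast ht
  have hP := sum_sampleProb M B z
  have hind : ∑ o, M.sampleProb B z i o * (if o = some j then (1 : ℝ) else 0) =
      M.sampleProb B z i (some j) := by simp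
  -- The bound on visits involves the choices of the other arms linearly, so independence from the
  -- choice of arm `i` lets them be averaged separately.
  have hE : ∑ σ : ∀ i, M.Choice B z i, (∏ i, M.sampleProb B z i (σ i)) *
      ((if σ i = some j then 1 else 0) * (M.pathProb u * (1 - 2 / t * ∑ i' ∈ univ.erase i,
        M.pending (2 * t - 1) ((σ i').map (M.forests B z i').get) (some (M.root i'))))) =
      M.sampleProb B z i (some j) * (M.pathProb u * (1 - 2 / t * ∑ i' ∈ univ.erase i,
        ∑ o, M.sampleProb B z i' o *
          M.pending (2 * t - 1) (o.map (M.forests B z i').get) (some (M.root i')))) := by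
    have h1 (σ : ∀ i, M.Choice B z i) : (∏ i, M.sampleProb B z i (σ i)) *
        ((if σ i = some j then 1 else 0) * (M.pathProb u * (1 - 2 / t * ∑ i' ∈ univ.erase i,
          M.pending (2 * t - 1) ((σ i').map (M.forests B z i').get) (some (M.root i'))))) =
        M.pathProb u * ((∏ i, M.sampleProb B z i (σ i)) * (if σ i = some j then 1 else 0)) -
          M.pathProb u * (2 / t) * ∑ i' ∈ univ.erase i, (∏ i, M.sampleProb B z i (σ i)) *
            ((if σ i = some j then 1 else 0) *
              M.pending (2 * t - 1) ((σ i').map (M.forests B z i').get) (some (M.root i'))) := by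
      simp only [← mul_sum]
      ring
    rw [sum_congr rfl fun σ _ => h1 σ, sum_sub_distrib, ← mul_sum, ← mul_sum,
      sum_prod_mul_eq hP i fun o => if o = some j then (1 : ℝ) else 0, hind, sum_comm,
      sum_congr rfl fun i' hi' => sum_prod_mul_mul_eq hP (ne_of_mem_erase hi').symm
      (fun o => if o = some j then (1 : ℝ) else 0) fun o =>
        M.pending (2 * t - 1) (o.map (M.forests B z i').get) (some (M.root i'))]
    simp only [hind, ← mul_sum]
    ring
  -- At most `2 * t / 8 = t / 4` plays are pending in expectation, and the Markov factor `2 / t`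
  -- turns this into `1 / 2`.
  have hhalf : (1 : ℝ) / 2 ≤ 1 - 2 / t * ∑ i' ∈ univ.erase i, ∑ o, M.sampleProb B z i' o *
      M.pending (2 * t - 1) (o.map (M.forests B z i').get) (some (M.root i')) := by
    have h1 := h.sum_pending_root_le i (2 * t - 1)
    have h2 : ((2 * t - 1 : ℕ) : ℝ) ≤ 2 * t := by exact_mod_cast Nat.sub_le _ _
    have h3 := mul_le_mul_of_nonneg_left (h1.trans (div_le_div_of_nonneg_right h2 (by norm_num)))
      (by positivity : (0 : ℝ) ≤ 2 / t)
    have h4 : 2 / (t : ℝ) * (2 * t / 8) = 1 / 2 := by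
      field_simp
      norm_num
    linarith
  calc M.sampleProb B z i (some j) * (M.pathProb u / 2)
      ≤ M.sampleProb B z i (some j) * (M.pathProb u * (1 - 2 / t * ∑ i' ∈ univ.erase i,
        ∑ o, M.sampleProb B z i' o *
          M.pending (2 * t - 1) (o.map (M.forests B z i').get) (some (M.root i')))) := by
        refine mul_le_mul_of_nonneg_left ?_ (h.sampleProb_nonneg _ _)
        rw [div_eq_mul_one_div]
        exact mul_le_mul_of_nonneg_left hhalf (M.pathProb_nonneg u)
    _ ≤ _ := by
        rw [← hE]
        refine sum_le_sum fun σ _ => mul_le_mul_of_nonneg_left ?_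
          (prod_nonneg fun i _ => h.sampleProb_nonneg _ _)
        split_ifs with hσ
        · rw [one_mul, one_mul]
          exact hle _ (by rw [hσ]; rfl)
        · simp

/-- The algorithm earns a constant fraction of the value of the linear program. -/
lemma lpValue_le_algReward : 1 / 48 * M.lpValue B z ≤ M.algReward B z := by
  have h1 (u : S) : ∑ j, (if ((M.forests B z (M.arm u)).get j).time u = ⊤ then 0 else
      M.sampleProb B z (M.arm u) (some j) * (M.pathProb u / 2)) ≤
      ∑ σ : ∀ i, M.Choice B z i, (∏ i, M.sampleProb B z i (σ i)) *
        M.visits (M.schedule fun i => (σ i).map (M.forests B z i).get) u B [] := by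
    have hnn (σ : ∀ i, M.Choice B z i) : 0 ≤ ∏ i, M.sampleProb B z i (σ i) :=
      prod_nonneg fun i _ => h.sampleProb_nonneg _ _
    calc _ ≤ ∑ j, ∑ σ : ∀ i, M.Choice B z i, (∏ i, M.sampleProb B z i (σ i)) *
          ((if σ (M.arm u) = some j then 1 else 0) *
            M.visits (M.schedule fun i => (σ i).map (M.forests B z i).get) u B []) := by
          refine sum_le_sum fun j _ => ?_
          split_ifs with hu
          · exact sum_nonneg fun σ _ => mul_nonneg (hnn σ)
              (mul_nonneg (by split_ifs <;> simp) (M.visits_nonneg _ _ _ _))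
          · exact h.half_le_sum_visits _ j hu
      _ ≤ _ := by
          rw [sum_comm]
          refine sum_le_sum fun σ _ => ?_
          -- An arm chooses at most one forest, so the indicators over `j` add up to at most one.
          rw [← mul_sum, ← sum_mul]
          refine mul_le_mul_of_nonneg_left ?_ (hnn σ)
          refine mul_le_of_le_one_left (M.visits_nonneg _ _ _ _) ?_
          rcases σ (M.arm u) with _ | j
          · simp
          · simp
  rw [algReward_eq_sum]
  refine le_trans (le_of_eq ?_) (sum_le_sum fun u _ => mul_le_mul_of_nonneg_left (h1 u)
    (M.r_nonneg u))
  rw [← h.sum_reward_forests]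
  have h2 (i : Fin n) (j : Fin (M.forests B z i).length) (u : S) (hu : M.arm u ≠ i) :
      ((M.forests B z i).get j).time u = ⊤ := by
    obtain ⟨F₀, h₀, h₁⟩ := h.isStrategyForest_forests_get i j
    by_contra h0
    rw [h₁] at h0
    exact hu ((h₀.of_isAdvancement h₀.isAdvancement_gapFill).arm_eq u h0)
  have h3 (u : S) : M.r u * ∑ j, (if ((M.forests B z (M.arm u)).get j).time u = ⊤ then 0 else
      M.sampleProb B z (M.arm u) (some j) * (M.pathProb u / 2)) =
      ∑ i, M.r u * ∑ j, (if ((M.forests B z i).get j).time u = ⊤ then 0 else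
        M.sampleProb B z i (some j) * (M.pathProb u / 2)) := by
    rw [sum_eq_single (M.arm u)]
    · intro i _ hi
      rw [sum_eq_zero, mul_zero]
      exact fun j _ => if_pos (h2 i j u hi.symm)
    · simp
  simp only [h3]
  rw [sum_comm, mul_sum]
  refine sum_congr rfl fun i _ => ?_
  simp only [mul_sum]
  rw [sum_comm]
  refine sum_congr rfl fun u _ => sum_congr rfl fun j _ => ?_
  split_ifs
  · simp
  · simp only [sampleProb]
    ring

end LPFeasible

end TreeMAB

end

/-- There is a universal constant `c > 0` such that, for every tree bandit and every budget `B`,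
the linear program has an optimal solution, and for each optimal solution `(z, w)`: the sampling
probabilities of the algorithm form a probability distribution; its expected reward within the
first `B` pulls is at least `c * LPOpt`; `LPOpt` is at least the expected reward of every adaptive
strategy; hence the algorithm is a constant-factor approximation. -/
theorem mainTheorem1 :
    ∃ c : ℝ, 0 < c ∧
      ∀ (n B : ℕ) (S : Type*) [Fintype S] (M : TreeMAB n S),
        (∃ z w : S → ℕ → ℝ, M.LPOptimal B z w) ∧
        ∀ z w : S → ℕ → ℝ, M.LPOptimal B z w →
          (∀ i o, 0 ≤ M.sampleProb B z i o) ∧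
          c * M.lpValue B z ≤ M.algReward B z ∧
          (∀ π : M.Strategy, M.reward B π ≤ M.lpValue B z) ∧
          (∀ π : M.Strategy, c * M.reward B π ≤ M.algReward B z) := by
  refine ⟨1 / 48, by norm_num, fun n B S _ M => ⟨M.exists_lpOptimal B, fun z w h => ?_⟩⟩
  refine ⟨h.1.sampleProb_nonneg, h.1.lpValue_le_algReward, M.reward_le_lpValue h, fun π => ?_⟩
  exact (mul_le_mul_of_nonneg_left (M.reward_le_lpValue h π) (by norm_num)).trans
    h.1.lpValue_le_algReward
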